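/- Let $d\ge 2$ be an integer, $\alpha\in(0,\tfrac12)$ a real number, $\rho=e^{2\pi i\alpha}$ and $\zeta=\rho^{-1}$. Let $(e_p)_{1\le p\le d}$ be the canonical basis of $\mathbb C^d$. For $1\le p\le d$ let $L_p\in GL_d(\mathbb C)$ be the operator $$L_p(e_q)=\begin{cases} e_q-e_p & q>p,\\ e_q-\zeta e_p & q<p,\\ -\zeta e_p & q=p,\end{cases}$$ let $\Gamma_{d}=\Gamma_{d,\alpha}$ be the group generated by $L_1,\dots,L_d$, and let $Q_\alpha$ be the hermitian form on $\mathbb C^d$ (linear in the first variable) with $Q_\alpha(e_p,e_p)=1$ and $Q_\alpha(e_p,e_{p'})=(1+\zeta)^{-1}$ for $p>p'$. Let $U(Q_\alpha)$ and $SU(Q_\alpha)$ be its unitary and special unitary groups, and let $SU^*(Q_\alpha)$ be the group of linear automorphisms of $\mathbb C^d$ of determinant $1$ that preserve $Q_\alpha$ and fix every vector of the kernel of $Q_\alpha$. The Zariski topology on $GL_d(\mathbb C)$ is the real one, whose closed sets are defined by real polynomials in the real and imaginary parts of the entries. **(1)** Assume that $d\ge 5$ and $d\alpha\in\mathbb Z$.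 Then $Q_\alpha$ is non-degenerate on $\mathbb C^d$, while its restriction to each coordinate hyperplane $H_p=\{x\in\mathbb C^d: x_p=0\}$ is degenerate. Suppose moreover that, in dimension $d-1$ (with the same $\alpha$), $\Gamma_{d-1}\cap SL(\mathbb C^{d-1})$ is dense for the usual topology, or Zariski dense, in $SU^*(Q'_\alpha)$, where $Q'_\alpha$ denotes the form $Q_\alpha$ on $\mathbb C^{d-1}$. Then $\Gamma_d\cap SU(Q_\alpha)$ is Zariski dense in $SU(Q_\alpha)$. **(2)** For all $d\ge2$ and $\alpha\in(0,\frac12)$, the group $\Gamma_d$ preserves $Q_\alpha$, and $Q_\alpha$ has signature $\big(\lceil (d+1)(1-\alpha)-1\rceil,\ \lceil (d+1)\alpha-1\rceil\big)$ (numbers of positive and of negative squares). Assume in addition that $\alpha\notin\{\frac16,\frac14\}$ and that $(d,\alpha)\notin\{(2,\frac1{10}),(2,\frac3{10})\}$. Then: * if $(d+1)\alpha<1$, then $\Gamma_d\cap SU(Q_\alpha)$ is dense in $SU(Q_\alpha)$ for the usual topology; * if $(d+1)\alpha\notin\mathbb Z$, then $\Gamma_d\cap SU(Q_\alpha)$ is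 Zariski dense in $SU(Q_\alpha)$. -/

import Mathlib

namespace RauzyVeech

noncomputable section

/-- `ρ = exp (2 π i α)`. -/
def rho (α : ℝ) : ℂ := Complex.exp (2 * Real.pi * Complex.I * α)

/-- `ζ = ρ⁻¹`. -/
def zeta (α : ℝ) : ℂ := (rho α)⁻¹

theorem rho_mul_zeta (α : ℝ) : rho α * zeta α = 1 :=
  mul_inv_cancel₀ (Complex.exp_ne_zero _)

theorem zeta_mul_rho (α : ℝ) : zeta α * rho α = 1 :=
  inv_mul_cancel₀ (Complex.exp_ne_zero _)

/-- The canonical basis vector `e_q` of `ℂ^d`. The ordered index set `{1-d, 3-d, …, d-1}` is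
replaced by `Fin d` through the increasing bijection `i ↦ 1 - d + 2 i`. -/
def e {d : ℕ} (q : Fin d) : Fin d → ℂ := Pi.single q 1

/-- The vector `L_p (e_q)`. -/
def opCol (α : ℝ) {d : ℕ} (p q : Fin d) : Fin d → ℂ :=
  if p < q then e q - e p
  else if q < p then e q - zeta α • e p
  else -(zeta α • e p)

/-- The vector `L_p⁻¹ (e_q)`. -/
def opInvCol (α : ℝ) {d : ℕ} (p q : Fin d) : Fin d → ℂ :=
  if q < p then e q - e p
  else if p < q then e q - rho α • e p
  else -(rho α • e p)

theorem opCol_eq (α : ℝ) {d : ℕ} (p q : Fin d) :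
    opCol α p q = e q - (if p < q then 1 else if q < p then zeta α else 1 + zeta α) • e p := by
  unfold opCol
  rcases lt_trichotomy p q with h | h | h
  · simp [h]
  · subst h; simp [add_smul]
  · simp [h, h.not_gt]

theorem opInvCol_eq (α : ℝ) {d : ℕ} (p q : Fin d) :
    opInvCol α p q = e q - (if q < p then 1 else if p < q then rho α else 1 + rho α) • e p := by
  unfold opInvCol
  rcases lt_trichotomy q p with h | h | h
  · simp [h]
  · subst h; simp [add_smul]
  · simp [h, h.not_gt]

/-- The operator `L_p` on `ℂ^d`, as an invertible matrix: its column of index `q` is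
`L_p (e_q)`. -/
def op (α : ℝ) {d : ℕ} (p : Fin d) : Matrix.GeneralLinearGroup (Fin d) ℂ where
  val := Matrix.of fun i q => opCol α p q i
  inv := Matrix.of fun i q => opInvCol α p q i
  val_inv := by
    have h := rho_mul_zeta α
    ext i q
    simp only [Matrix.mul_apply, Matrix.of_apply, opInvCol_eq, opCol_eq, e, Pi.sub_apply,
      Pi.smul_apply, smul_eq_mul, mul_sub, sub_mul, Finset.sum_sub_distrib, Pi.single_apply]
    rcases lt_trichotomy q p with hq | hq | hq <;> by_cases hi : i = p <;>
      simp [hq, hq.not_gt, hi, Matrix.one_apply, eq_comm] <;>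
      grind
  inv_val := by
    have h := rho_mul_zeta α
    ext i q
    simp only [Matrix.mul_apply, Matrix.of_apply, opInvCol_eq, opCol_eq, e, Pi.sub_apply,
      Pi.smul_apply, smul_eq_mul, mul_sub, sub_mul, Finset.sum_sub_distrib, Pi.single_apply]
    rcases lt_trichotomy q p with hq | hq | hq <;> by_cases hi : i = p <;>
      simp [hq, hq.not_gt, hi, Matrix.one_apply, eq_comm] <;>
      grind

/-- The subgroup of `GL(ℂ^d)` generated by the operators `L_p`. -/
def opGroup (α : ℝ) (d : ℕ) : Subgroup (Matrix.GeneralLinearGroup (Fin d) ℂ) :=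
  Subgroup.closure (Set.range (op α))

/-- `Q_α (e_p, e_q)`. -/
def gram (α : ℝ) {d : ℕ} (p q : Fin d) : ℂ :=
  if p = q then 1
  else if q < p then (1 + zeta α)⁻¹
  else (starRingEnd ℂ) (1 + zeta α)⁻¹

/-- The hermitian form `Q_α` on `ℂ^d`, linear in the first and conjugate-linear in the second
variable. -/
def form (α : ℝ) {d : ℕ} (x y : Fin d → ℂ) : ℂ :=
  ∑ p, ∑ q, x p * (starRingEnd ℂ) (y q) * gram α p q

/-- The hermitian form `Q_α` on `ℂ^d` has signature `(a, b)`: some orthogonal basis of `ℂ^d` has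
exactly `a` vectors on which it is positive and `b` vectors on which it is negative. -/
def HasSignature (α : ℝ) (d : ℕ) (a b : ℤ) : Prop :=
  ∃ v : Module.Basis (Fin d) ℂ (Fin d → ℂ),
    (∀ i j, i ≠ j → form α (v i) (v j) = 0) ∧
    (Nat.card {i : Fin d // 0 < (form α (v i) (v i)).re} : ℤ) = a ∧
    (Nat.card {i : Fin d // (form α (v i) (v i)).re < 0} : ℤ) = b

/-- The kernel of `Q_α`. -/
def kernel (α : ℝ) (d : ℕ) : Set (Fin d → ℂ) := {x | ∀ y, form α x y = 0}

/-- The unitary group `U(Q_α)`. -/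
def U (α : ℝ) (d : ℕ) : Subgroup (Matrix.GeneralLinearGroup (Fin d) ℂ) where
  carrier := {g | ∀ x y, form α (g.1.mulVec x) (g.1.mulVec y) = form α x y}
  mul_mem' := by
    intro a b ha hb x y
    simp only [Units.val_mul, ← Matrix.mulVec_mulVec]
    rw [ha, hb]
  one_mem' := by intro x y; simp
  inv_mem' := by
    intro a ha x y
    have h : ∀ z : Fin d → ℂ, a.1.mulVec ((a⁻¹).1.mulVec z) = z := by
      intro z
      rw [Matrix.mulVec_mulVec, ← Units.val_mul, mul_inv_cancel, Units.val_one, Matrix.one_mulVec]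
    rw [← ha, h, h]

/-- `SL(ℂ^d)`, as a subgroup of `GL(ℂ^d)`. -/
def SL (d : ℕ) : Subgroup (Matrix.GeneralLinearGroup (Fin d) ℂ) :=
  Matrix.GeneralLinearGroup.det.ker

/-- The special unitary group `SU(Q_α)`. -/
def SU (α : ℝ) (d : ℕ) : Subgroup (Matrix.GeneralLinearGroup (Fin d) ℂ) := U α d ⊓ SL d

/-- The group `SU^*(Q_α)` of automorphisms of `ℂ^d` of determinant `1` that preserve `Q_α` and fix
each vector of the kernel of `Q_α`. -/
def SUstar (α : ℝ) (d : ℕ) : Subgroup (Matrix.GeneralLinearGroup (Fin d) ℂ) where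
  carrier := {g | g ∈ SU α d ∧ ∀ x ∈ kernel α d, g.1.mulVec x = x}
  mul_mem' := by
    rintro a b ⟨ha, ha'⟩ ⟨hb, hb'⟩
    refine ⟨mul_mem ha hb, fun x hx => ?_⟩
    rw [Units.val_mul, ← Matrix.mulVec_mulVec, hb' x hx, ha' x hx]
  one_mem' := ⟨one_mem _, fun x _ => by simp⟩
  inv_mem' := by
    rintro a ⟨ha, ha'⟩
    refine ⟨inv_mem ha, fun x hx => ?_⟩
    conv_lhs => rw [← ha' x hx]
    rw [Matrix.mulVec_mulVec, ← Units.val_mul, inv_mul_cancel, Units.val_one, Matrix.one_mulVec]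

/-- The real coordinates of a complex matrix: real parts and imaginary parts of its entries. -/
def realCoord {d : ℕ} (M : Matrix (Fin d) (Fin d) ℂ) :
    (Fin d × Fin d) ⊕ (Fin d × Fin d) → ℝ :=
  Sum.elim (fun ij => (M ij.1 ij.2).re) (fun ij => (M ij.1 ij.2).im)

/-- The closure of `S ⊆ GL(ℂ^d)` in the (real) Zariski topology: the common zeros of the real
polynomials in the real and imaginary parts of the entries that vanish on `S`. -/
def zariskiClosure {d : ℕ} (S : Set (Matrix.GeneralLinearGroup (Fin d) ℂ)) :
    Set (Matrix.GeneralLinearGroup (Fin d) ℂ) :=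
  {g | ∀ P : MvPolynomial ((Fin d × Fin d) ⊕ (Fin d × Fin d)) ℝ,
    (∀ h ∈ S, MvPolynomial.eval (realCoord h.1) P = 0) → MvPolynomial.eval (realCoord g.1) P = 0}

/-- `A` is a Zariski dense subgroup of `B`. -/
def ZariskiDenseIn {d : ℕ} (A B : Subgroup (Matrix.GeneralLinearGroup (Fin d) ℂ)) : Prop :=
  A ≤ B ∧ (B : Set (Matrix.GeneralLinearGroup (Fin d) ℂ)) ⊆ zariskiClosure A

/-- `A` is a dense subgroup of `B`, for the usual topology. -/
def DenseIn {d : ℕ} (A B : Subgroup (Matrix.GeneralLinearGroup (Fin d) ℂ)) : Prop :=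
  A ≤ B ∧ (B : Set (Matrix.GeneralLinearGroup (Fin d) ℂ)) ⊆ closure A

end

end RauzyVeech

/-!
The operators `L_p` are complex reflections: `L_p = 1 - (1 + ζ) P_p`, where `P_p` is the orthogonal
projection to the unit vector `e_p` with respect to `Q_α`. The density of `Γ = Γ_d ∩ SU (Q_α)` is
obtained through the tangent space `T` at `1` of the *complex* Zariski closure of `Γ`.

* The space `T` is stable under conjugation by the `L_p`. Such a space contains, with a matrix `Y`,
  its component of weight `-ζ` under `L_p`, which is a rank one matrix `e_p ⊗ ψ` with `ψ (e_p) = 0`.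
  If the form is nondegenerate and `T` is not reduced to scalars, the conjugations by the other
  reflections produce from these all the off-diagonal elementary matrices
  (`single_mem_of_conj_mem`). A tangent vector of square zero is the direction of a line in the
  closure (`one_add_smul_mem_zclosure`), so that the closure contains the transvections, hence
  `SL_d (ℂ)`.

* A nonscalar tangent vector (`exists_mem_tangent`) comes from a Laurent curve with infinitely many
  points in the closure (`sub_mem_tangent`). If `ζ` is not a root of unity, the curve is
  `C_p (s) C_q (s⁻¹)`, where `C_p (s)` is the reflection in `e_p` with eigenvalue `s`. Otherwise it
  is the torus through an element of infinite order: for two vectors `x`, `y` in the orbit of the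
  `e_p`, the product of the reflection in `x` and the inverse of the reflection in `y` acts on their span
  with determinant `1` and with a trace that is an integral polynomial in `-ζ`. When a Galois
  conjugate of this trace is real and larger than `2`, the eigenvalues are not roots of unity, as is
  seen by means of the Dickson polynomials. Suitable pairs exist in all cases except for
  `α = 1/6`, `α = 1/4` and, in dimension two, `α = 1/10`, `3/10`, `1/3`, where a lower bound on the
  dimension is needed. In the first part of the theorem, `α = 1/6` and `d α ∈ ℤ` imply `6 ≤ d`; and
  `α = 1/3` in dimension two belongs to a degenerate form.

* On `SU (Q_α)`, for a nondegenerate form, the conjugates of the entries are polynomials in the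
  entries, so that a real polynomial in the real and imaginary parts is the restriction of a complex
  polynomial. Therefore `Γ` is dense for the real Zariski topology (`zariskiDenseIn_SU`).

* The Gram matrix of `Q_α` is a circulant matrix up to a twist: for the `d`-th roots `l` of `ρ`, the
  vectors `(l⁻ᵖ)_p` are orthogonal eigenvectors, with eigenvalues that are quotients of sines. This
  gives the signature (`hasSignature`) and shows that the form is degenerate exactly when
  `(d + 1) α` is an integer. The restriction of `Q_α` to a coordinate hyperplane is the form in
  dimension `d - 1`, which is degenerate if `d α` is an integer.

* If `(d + 1) α < 1`, the form is definite and `SU (Q_α)` is compact. A closed subgroup of a compact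
  group is the zero set of real polynomials: those given by the Stone-Weierstrass theorem are made
  invariant by averaging with respect to the Haar measure
  (`subset_closure_of_subset_zariskiClosure`). Hence Zariski density implies density.
-/

namespace RauzyVeech

open Matrix

/-! ### Polynomials in the entries of a matrix and invariant vector fields -/

section Translation

open MvPolynomial

/-- The value of a polynomial in the entries of a matrix. -/
noncomputable def evalMat {n : Type*} (M : Matrix n n ℂ) : MvPolynomial (n × n) ℂ →ₐ[ℂ] ℂ :=
  aeval fun ij => M ij.1 ij.2

@[simp] theorem evalMat_X {n : Type*} (M : Matrix n n ℂ) (ij : n × n) :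
    evalMat M (X ij) = M ij.1 ij.2 := by
  simp [evalMat]

@[simp] theorem evalMat_C {n : Type*} (M : Matrix n n ℂ) (a : ℂ) :
    evalMat M (C a) = a := by
  simp [evalMat]

theorem evalMat_mvPolynomialX {n : Type*} (M : Matrix n n ℂ) :
    (mvPolynomialX n n ℂ).map (evalMat M) = M := by
  ext i j; simp

theorem evalMat_map_C {n : Type*} (M A : Matrix n n ℂ) : (A.map C).map (evalMat M) = A := by
  ext i j; simp

theorem evalMat_apply_mul {n : Type*} [Fintype n] (M : Matrix n n ℂ)
    (A B : Matrix n n (MvPolynomial (n × n) ℂ)) (i j : n) :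
    evalMat M ((A * B) i j) = (A.map (evalMat M) * B.map (evalMat M)) i j := by
  simp [Matrix.mul_apply]

/-- A derivation and an algebra homomorphism that commute on the variables commute. -/
theorem derivation_algHom_comm {σ A : Type*} [CommRing A] [Algebra ℂ A]
    (φ : MvPolynomial σ ℂ →ₐ[ℂ] A) (D : Derivation ℂ A A)
    (D' : Derivation ℂ (MvPolynomial σ ℂ) (MvPolynomial σ ℂ))
    (h : ∀ i, D (φ (X i)) = φ (D' (X i))) (P : MvPolynomial σ ℂ) :
    D (φ P) = φ (D' P) := by
  induction P using MvPolynomial.induction_on with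
  | C a =>
    have h1 : φ (C a) = algebraMap ℂ A a := φ.commutes a
    rw [h1, Derivation.map_algebraMap, derivation_C, map_zero]
  | add p q hp hq => simp [hp, hq]
  | mul_X p i hp => simp [hp, h]

variable {n : Type*} [Fintype n]

/-- The substitution `M ↦ A * M * B` in the polynomials in the entries of `M`. -/
noncomputable def translate (A B : Matrix n n ℂ) :
    MvPolynomial (n × n) ℂ →ₐ[ℂ] MvPolynomial (n × n) ℂ :=
  aeval fun ij => (A.map C * mvPolynomialX n n ℂ * B.map C : Matrix n n (MvPolynomial (n × n) ℂ))
    ij.1 ij.2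

theorem evalMat_translate (M A B : Matrix n n ℂ) (P : MvPolynomial (n × n) ℂ) :
    evalMat M (translate A B P) = evalMat (A * M * B) P := by
  have : (evalMat M).comp (translate A B) = evalMat (A * M * B) := by
    refine MvPolynomial.algHom_ext fun ij => ?_
    simp only [translate, AlgHom.comp_apply, aeval_X, evalMat_apply_mul, Matrix.map_mul,
      evalMat_mvPolynomialX, evalMat_map_C, evalMat_X]
  exact DFunLike.congr_fun this P

/-- The left-invariant vector field on matrices whose value at `1` is `Y`: the derivation with
`(invField Y P) (g) = d/ds P (g (1 + s Y))` at `s = 0`. -/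
noncomputable def invField (Y : Matrix n n ℂ) :
    Derivation ℂ (MvPolynomial (n × n) ℂ) (MvPolynomial (n × n) ℂ) :=
  mkDerivation ℂ fun ij => (mvPolynomialX n n ℂ * Y.map C : Matrix n n (MvPolynomial (n × n) ℂ))
    ij.1 ij.2

@[simp] theorem invField_X (Y : Matrix n n ℂ) (ij : n × n) :
    invField Y (X ij) = (mvPolynomialX n n ℂ * Y.map C : Matrix n n (MvPolynomial (n × n) ℂ))
      ij.1 ij.2 :=
  mkDerivation_X _ _ _

theorem invField_add (Y Z : Matrix n n ℂ) : invField (Y + Z) = invField Y + invField Z := by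
  refine derivation_ext fun ij => ?_
  simp [Matrix.mul_apply, mul_add, Finset.sum_add_distrib]

theorem invField_smul (a : ℂ) (Y : Matrix n n ℂ) : invField (a • Y) = a • invField Y := by
  refine derivation_ext fun ij => ?_
  simp only [invField_X, Derivation.smul_apply, Matrix.mul_apply, Finset.smul_sum]
  refine Finset.sum_congr rfl fun k _ => ?_
  simp [MvPolynomial.smul_eq_C_mul]
  ring

/-- The vector field is invariant under left translations, and right translations change it by the
adjoint action. -/
theorem invField_translate [DecidableEq n] (A B B' Y : Matrix n n ℂ) (hB : B * B' = 1)
    (P : MvPolynomial (n × n) ℂ) :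
    invField Y (translate A B P) = translate A B (invField (B' * Y * B) P) := by
  refine derivation_algHom_comm (translate A B) (invField Y) (invField (B' * Y * B))
    (fun ij => ?_) P
  have h1 : ∀ Z : Matrix n n (MvPolynomial (n × n) ℂ),
      (translate A B) ((mvPolynomialX n n ℂ * Z) ij.1 ij.2) =
        (A.map C * mvPolynomialX n n ℂ * B.map C * Z.map (translate A B) :
          Matrix n n (MvPolynomial (n × n) ℂ)) ij.1 ij.2 := by
    intro Z
    rw [Matrix.mul_apply, Matrix.mul_apply, map_sum]
    refine Finset.sum_congr rfl fun k _ => ?_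
    simp [translate]
  have h2 : ∀ Z : Matrix n n ℂ, (Z.map C).map (translate A B) = Z.map C := by
    intro Z; ext1 i j; exact (translate A B).commutes _
  have h3 : ∀ (Z : Matrix n n (MvPolynomial (n × n) ℂ)) (i j : n),
      invField Y ((A.map C * Z * B.map C : Matrix n n (MvPolynomial (n × n) ℂ)) i j) =
        (A.map C * Z.map (invField Y) * B.map C : Matrix n n (MvPolynomial (n × n) ℂ)) i j := by
    intro Z i j
    simp [Matrix.mul_apply, mul_comm]
  have h4 : (mvPolynomialX n n ℂ).map (invField Y) = mvPolynomialX n n ℂ * Y.map C := by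
    ext1 i j; simp
  have h5 : (B.map C * (B' * Y * B).map C : Matrix n n (MvPolynomial (n × n) ℂ))
      = Y.map C * B.map C := by
    rw [← Matrix.map_mul, ← Matrix.map_mul, ← Matrix.mul_assoc, ← Matrix.mul_assoc, hB,
      Matrix.one_mul]
  rw [invField_X, h1, h2]
  simp only [translate, aeval_X]
  rw [h3, h4, Matrix.mul_assoc _ (B.map C), h5]
  simp only [Matrix.mul_assoc]

end Translation

/-! ### The complex Zariski closure of a group and its tangent space -/

section Closure

open MvPolynomial

variable {n : Type*} [Fintype n] [DecidableEq n]

/-- The polynomial `P` vanishes on the group `N`. -/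
def VanishesOn (N : Subgroup (GL n ℂ)) (P : MvPolynomial (n × n) ℂ) : Prop :=
  ∀ h ∈ N, evalMat h.1 P = 0

/-- The closure of the group `N` in the set of all matrices, for the complex Zariski topology. -/
def zclosure (N : Subgroup (GL n ℂ)) : Set (Matrix n n ℂ) :=
  {M | ∀ P, VanishesOn N P → evalMat M P = 0}

theorem subset_zclosure {N : Subgroup (GL n ℂ)} {g : GL n ℂ} (hg : g ∈ N) :
    g.1 ∈ zclosure N := fun _ hP => hP g hg

/-- The closure of a group is stable under products: first with a factor in the group, then in
general. -/
theorem mul_mem_zclosure {N : Subgroup (GL n ℂ)} {A B : Matrix n n ℂ} (hA : A ∈ zclosure N)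
    (hB : B ∈ zclosure N) : A * B ∈ zclosure N := by
  have key : ∀ s ∈ N, s.1 * B ∈ zclosure N := by
    intro s hs P hP
    have := hB (translate s.1 1 P) fun h hh => by
      rw [evalMat_translate, Matrix.mul_one]
      exact hP (s * h) (mul_mem hs hh)
    rwa [evalMat_translate, Matrix.mul_one] at this
  intro P hP
  have := hA (translate 1 B P) fun h hh => by
    rw [evalMat_translate, Matrix.one_mul]
    exact key h hh P hP
  rwa [evalMat_translate, Matrix.one_mul] at this

/-- The tangent space at `1` of the Zariski closure of `N`. -/
noncomputable def tangent (N : Subgroup (GL n ℂ)) : Submodule ℂ (Matrix n n ℂ) where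
  carrier := {Y | ∀ P, VanishesOn N P → evalMat 1 (invField Y P) = 0}
  zero_mem' := by
    intro P _
    have := invField_smul (0 : ℂ) (0 : Matrix n n ℂ)
    rw [zero_smul, zero_smul] at this
    simp [this]
  add_mem' := by
    intro Y Z hY hZ P hP
    simp [invField_add, hY P hP, hZ P hP]
  smul_mem' := by
    intro a Y hY P hP
    simp [invField_smul, hY P hP]

/-- The tangent space is stable under conjugation by the normalizer. -/
theorem conj_mem_tangent {N : Subgroup (GL n ℂ)} {γ : GL n ℂ}
    (hγ : ∀ h ∈ N, γ * h * γ⁻¹ ∈ N) {Y : Matrix n n ℂ} (hY : Y ∈ tangent N) :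
    γ.1 * Y * (γ⁻¹).1 ∈ tangent N := by
  intro P hP
  have h1 : γ.1 * (γ⁻¹).1 = 1 := by rw [← Units.val_mul, mul_inv_cancel, Units.val_one]
  have h2 : (γ⁻¹).1 * γ.1 = 1 := by rw [← Units.val_mul, inv_mul_cancel, Units.val_one]
  have h3 : VanishesOn N (translate γ.1 (γ⁻¹).1 P) := fun h hh => by
    rw [evalMat_translate]
    exact hP (γ * h * γ⁻¹) (hγ h hh)
  have := hY _ h3
  rwa [invField_translate _ _ _ _ h2, evalMat_translate, Matrix.mul_one, h1] at this

/-- The polynomials that vanish on `N` are stable under the left-invariant vector fields of the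
tangent vectors, because `N` is stable under its left translations. -/
theorem VanishesOn.invField {N : Subgroup (GL n ℂ)} {P : MvPolynomial (n × n) ℂ}
    (hP : VanishesOn N P) {Y : Matrix n n ℂ} (hY : Y ∈ tangent N) :
    VanishesOn N (invField Y P) := by
  intro g hg
  have := hY (translate g.1 1 P) fun h hh => by
    rw [evalMat_translate, Matrix.mul_one]
    exact hP (g * h) (mul_mem hg hh)
  rwa [invField_translate _ _ 1 _ (Matrix.mul_one 1), evalMat_translate, Matrix.mul_one,
    Matrix.mul_one, Matrix.mul_one, Matrix.one_mul] at this

/-- The one-parameter group generated by a tangent vector of square zero is contained in the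
Zariski closure: the polynomials vanishing on `N` are stable under the vector field, so that all
derivatives along the curve vanish at the origin. -/
theorem one_add_smul_mem_zclosure {N : Subgroup (GL n ℂ)} {Y : Matrix n n ℂ}
    (hY : Y ∈ tangent N) (hYY : Y * Y = 0) (s : ℂ) : 1 + s • Y ∈ zclosure N := by
  let f : MvPolynomial (n × n) ℂ →ₐ[ℂ] Polynomial ℂ :=
    aeval fun ij => Polynomial.C ((1 : Matrix n n ℂ) ij.1 ij.2) +
      Polynomial.X * Polynomial.C (Y ij.1 ij.2)
  have hf : ∀ (s : ℂ) P, (f P).eval s = evalMat (1 + s • Y) P := by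
    intro s P
    have : (Polynomial.aeval s).comp f = evalMat (1 + s • Y) := by
      refine MvPolynomial.algHom_ext fun ij => ?_
      simp [f, mul_comm (Y _ _)]
    rw [← this]; simp
  have hD : ∀ P, Polynomial.derivative (f P) = f (invField Y P) := by
    refine fun P => derivation_algHom_comm f Polynomial.derivative' _ (fun ij => ?_) P
    refine Polynomial.funext fun s => ?_
    rw [invField_X, hf, evalMat_apply_mul, evalMat_mvPolynomialX, evalMat_map_C, Matrix.add_mul,
      Matrix.smul_mul, hYY]
    simp [f]
  have key : ∀ (m : ℕ) P, VanishesOn N P → (f P).natDegree ≤ m → f P = 0 := by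
    have h0 : ∀ P, VanishesOn N P → (f P).eval 0 = 0 := by
      intro P hP
      rw [hf, zero_smul, add_zero]
      exact hP 1 (one_mem _)
    have hc : ∀ P, VanishesOn N P → Polynomial.derivative (f P) = 0 → f P = 0 := by
      intro P hP h
      have h1 := Polynomial.eq_C_of_derivative_eq_zero h
      have h2 := h0 P hP
      rw [h1, Polynomial.eval_C] at h2
      rw [h1, h2, map_zero]
    intro m
    induction m with
    | zero =>
      intro P hP hm
      refine hc P hP ?_
      rw [Polynomial.eq_C_of_natDegree_le_zero hm, Polynomial.derivative_C]
    | succ m ih =>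
      intro P hP hm
      refine hc P hP ?_
      rw [hD]
      refine ih _ (hP.invField hY) ?_
      rw [← hD]
      exact (Polynomial.natDegree_derivative_le _).trans (by omega)
  intro P hP
  rw [← hf, key _ P hP le_rfl, Polynomial.eval_zero]

/-- The chain rule: along a curve that passes through `1` with velocity `Y`, the derivative of a
polynomial is given by the vector field of `Y`. -/
theorem hasDerivAt_evalMat {T : ℂ → Matrix n n ℂ} {Y : Matrix n n ℂ} {s : ℂ} (h1 : T s = 1)
    (hT : ∀ i j, HasDerivAt (fun z => T z i j) (Y i j) s) (P : MvPolynomial (n × n) ℂ) :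
    HasDerivAt (fun z => evalMat (T z) P) (evalMat 1 (invField Y P)) s := by
  induction P using MvPolynomial.induction_on with
  | C a => simpa using hasDerivAt_const s a
  | add p q hp hq => simpa using! hp.add hq
  | mul_X p i hp =>
    have h : evalMat 1 (invField Y (X i)) = Y i.1 i.2 := by
      rw [invField_X, evalMat_apply_mul, evalMat_mvPolynomialX, evalMat_map_C, Matrix.one_mul]
    have := hp.mul (hT i.1 i.2)
    rw [h1] at this
    simp only [map_mul, evalMat_X, Derivation.leibniz, map_add, smul_eq_mul, h]
    convert! this using 1
    ring

/-- A Laurent curve through `1` with infinitely many points in the closure of `N` yields a tangent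
vector. -/
theorem sub_mem_tangent {N : Subgroup (GL n ℂ)} {A B D : Matrix n n ℂ} (h1 : A + B + D = 1)
    {S : Set ℂ} (hS : S.Infinite) (hN : ∀ s ∈ S, s ≠ 0 → A + s • B + s⁻¹ • D ∈ zclosure N) :
    B - D ∈ tangent N := by
  intro P hP
  have hpoly : ∀ P : MvPolynomial (n × n) ℂ, ∃ (k : ℕ) (p : Polynomial ℂ), ∀ s : ℂ, s ≠ 0 →
      s ^ k * evalMat (A + s • B + s⁻¹ • D) P = p.eval s := by
    intro P
    induction P using MvPolynomial.induction_on with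
    | C a => exact ⟨0, Polynomial.C a, fun s _ => by simp⟩
    | add p q hp hq =>
      obtain ⟨k, f, hf⟩ := hp
      obtain ⟨l, g, hg⟩ := hq
      refine ⟨k + l, Polynomial.X ^ l * f + Polynomial.X ^ k * g, fun s hs => ?_⟩
      simp only [Polynomial.eval_add, Polynomial.eval_mul, Polynomial.eval_pow,
        Polynomial.eval_X, ← hf s hs, ← hg s hs, map_add]
      ring
    | mul_X p i hp =>
      obtain ⟨k, f, hf⟩ := hp
      refine ⟨k + 1, f * (Polynomial.C (A i.1 i.2) * Polynomial.X +
        Polynomial.C (B i.1 i.2) * Polynomial.X ^ 2 + Polynomial.C (D i.1 i.2)), fun s hs => ?_⟩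
      simp only [Polynomial.eval_add, Polynomial.eval_mul, Polynomial.eval_pow,
        Polynomial.eval_X, Polynomial.eval_C, ← hf s hs, map_mul, evalMat_X, Matrix.add_apply,
        Matrix.smul_apply, smul_eq_mul]
      have hs1 : s * s⁻¹ = 1 := mul_inv_cancel₀ hs
      linear_combination (s ^ k * evalMat (A + s • B + s⁻¹ • D) p * D i.1 i.2) * hs1
  -- The Laurent polynomial obtained in this way has infinitely many zeros, so that it vanishes
  -- identically, and so does its derivative at `1`.
  obtain ⟨k, p, hp⟩ := hpoly P
  have hp0 : p = 0 := by
    refine Polynomial.eq_zero_of_infinite_isRoot p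
      ((hS.sdiff (Set.finite_singleton 0)).mono fun s hs => ?_)
    have hs0 : s ≠ 0 := by simpa using hs.2
    have := hp s hs0
    rw [hN s hs.1 hs0 P hP, mul_zero] at this
    exact this.symm
  have hz : ∀ s : ℂ, s ≠ 0 → evalMat (A + s • B + s⁻¹ • D) P = 0 := by
    intro s hs
    have := hp s hs
    rw [hp0, Polynomial.eval_zero] at this
    exact (mul_eq_zero.1 this).resolve_left (pow_ne_zero _ hs)
  have hd := hasDerivAt_evalMat (T := fun s => A + s • B + s⁻¹ • D) (Y := B - D) (s := 1)
    (by simpa using h1) (fun i j => by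
      have h2 := (((hasDerivAt_id (1 : ℂ)).mul_const (B i j)).const_add (A i j)).add
        ((hasDerivAt_inv (one_ne_zero : (1 : ℂ) ≠ 0)).mul_const (D i j))
      convert! h2 using 1
      simp [sub_eq_add_neg]) P
  refine hd.unique ((hasDerivAt_const (1 : ℂ) (0 : ℂ)).congr_of_eventuallyEq ?_)
  filter_upwards [isOpen_ne.mem_nhds (one_ne_zero : (1 : ℂ) ≠ 0)] with s hs
  exact hz s hs

/-- If the off-diagonal elementary matrices are tangent, then the closure contains all
transvections, and these generate `SL`. -/
theorem mem_zclosure_of_det_eq_one [Nontrivial n] {N : Subgroup (GL n ℂ)}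
    (hN : ∀ i j : n, i ≠ j → Matrix.single i j (1 : ℂ) ∈ tangent N)
    (M : Matrix n n ℂ) (hM : M.det = 1) : M ∈ zclosure N := by
  have htr : ∀ (i j : n) (hij : i ≠ j) (a : ℂ), transvection i j a ∈ zclosure N := by
    intro i j hij a
    have := one_add_smul_mem_zclosure (hN i j hij) (by simp [hij.symm]) a
    simpa [transvection] using this
  refine SpecialLinearGroup.diagonal_transvection_induction' (fun g => g.1 ∈ zclosure N)
    ⟨M, hM⟩ ?_ ?_ ?_
  · intro i j hij c hc
    -- The classical factorization of `diag (c, c⁻¹)` into transvections.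
    have h : (SpecialLinearGroup.diag2n hij c hc).1 =
        transvection i j c * transvection j i (-c⁻¹) * transvection i j c *
          (transvection i j (-1) * transvection j i 1 * transvection i j (-1)) := by
      rw [SpecialLinearGroup.diag2n_coe]
      have hc' : c * c⁻¹ = 1 := mul_inv_cancel₀ hc
      simp only [transvection, mul_add, add_mul, Matrix.one_mul, Matrix.mul_one,
        single_mul_single_same, single_mul_single_of_ne _ _ _ _ hij,
        single_mul_single_of_ne _ _ _ _ hij.symm, add_zero]
      ext k l
      simp only [Matrix.add_apply, single_apply, diagonal_apply, Matrix.one_apply]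
      grind
    rw [h]
    have := @mul_mem_zclosure n _ _ N
    refine this (this (this ?_ ?_) ?_) (this (this ?_ ?_) ?_) <;>
    exact htr _ _ (by first | exact hij | exact hij.symm) _
  · intro i j hij a
    exact htr i j hij a
  · intro A B hA hB
    exact mul_mem_zclosure hA hB

end Closure

/-! ### Spaces of matrices stable under conjugation by complex reflections -/

section LinearAlgebra

variable {n : Type*} [Fintype n] [DecidableEq n]

/-- A subspace stable under conjugation by `L = 1 - (1 - t) P`, for a projection `P`, contains the
component of weight `t` of each of its elements. -/
theorem mul_mul_one_sub_mem_of_conj_mem {T : Submodule ℂ (Matrix n n ℂ)} {P L L' : Matrix n n ℂ}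
    {t : ℂ} (ht0 : t ≠ 0) (ht : t ^ 2 ≠ 1) (hP : P * P = P) (hL : L = 1 - (1 - t) • P)
    (hL' : L' = 1 - (1 - t⁻¹) • P) (hT : ∀ Y ∈ T, L * Y * L' ∈ T) {Y : Matrix n n ℂ} (hY : Y ∈ T) :
    P * Y * (1 - P) ∈ T := by
  set Q := 1 - P with hQ
  have hPQ : P * Q = 0 := by rw [hQ, mul_sub, mul_one, hP, sub_self]
  have hQP : Q * P = 0 := by rw [hQ, sub_mul, one_mul, hP, sub_self]
  have hQQ : Q * Q = Q := by rw [hQ, mul_sub, mul_one, ← hQ, hQP, sub_zero]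
  have hLQ : L = Q + t • P := by rw [hL, hQ, sub_smul, one_smul]; abel
  have hLQ' : L' = Q + t⁻¹ • P := by rw [hL', hQ, sub_smul, one_smul]; abel
  have e0 : Y = Q * Y * Q + Q * Y * P + P * Y * Q + P * Y * P := by
    rw [hQ]; noncomm_ring
  have e1 : ∀ s s' : ℂ, (Q + s • P) * Y * (Q + s' • P) =
      Q * Y * Q + s' • (Q * Y * P) + s • (P * Y * Q) + (s * s') • (P * Y * P) := by
    intro s s'
    simp only [add_mul, mul_add, Matrix.smul_mul, Matrix.mul_smul, smul_smul]
    module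
  have e2 : L * L = Q + (t * t) • P := by
    rw [hLQ]
    simp [add_mul, mul_add, hPQ, hQP, hQQ, hP, smul_smul]
  have e3 : L' * L' = Q + (t⁻¹ * t⁻¹) • P := by
    rw [hLQ']
    simp [add_mul, mul_add, hPQ, hQP, hQQ, hP, smul_smul]
  have h1 := hT Y hY
  have h2 := hT _ h1
  -- The four components of `Y` have the weights `1`, `t⁻¹`, `t`, `1` under the conjugation by `L`;
  -- the operator `(Ad L - 1) (Ad L - t⁻¹)` kills all of them but the one of weight `t`.
  have key : ((t - t⁻¹) * (t - 1)) • (P * Y * Q) =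
      (L * (L * Y * L') * L' - L * Y * L') - t⁻¹ • (L * Y * L' - Y) := by
    rw [show L * (L * Y * L') * L' = (L * L) * Y * (L' * L') by simp only [mul_assoc], e2, e3, e1,
      hLQ, hLQ', e1]
    generalize Q * Y * Q = A₁ at e0 ⊢
    generalize Q * Y * P = A₂ at e0 ⊢
    generalize P * Y * Q = A₃ at e0 ⊢
    generalize P * Y * P = A₄ at e0 ⊢
    rw [e0]
    match_scalars <;> field_simp <;> ring
  have hne : (t - t⁻¹) * (t - 1) ≠ 0 := by
    have h1 : t ≠ 1 := fun h => ht (by simp [h])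
    refine mul_ne_zero (fun h => ht ?_) (sub_ne_zero.2 h1)
    field_simp at h
    linear_combination h
  rw [← T.smul_mem_iff hne, key]
  exact T.sub_mem (T.sub_mem h2 h1) (T.smul_mem _ (T.sub_mem h1 hY))

/-- The core of the density theorem. A subspace `T` of matrices, stable under conjugation by the
complex reflections `L p = 1 - (1 - t) e_p ⊗ Λ_p`, that contains a matrix which is not scalar
contains all off-diagonal elementary matrices. By the previous lemma `T` contains elements
`e_p ⊗ ψ`, where `ψ` vanishes at `e_p`, and the conjugations by the other reflections move them
until all `e_p ⊗ ψ` with `ψ (e_p) = 0` are obtained. -/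
theorem single_mem_of_conj_mem {T : Submodule ℂ (Matrix n n ℂ)} {Λ : Matrix n n ℂ}
    {L L' : n → Matrix n n ℂ} {t : ℂ} (ht0 : t ≠ 0) (ht : t ^ 2 ≠ 1) (hΛ : IsUnit Λ.det)
    (hdiag : ∀ p, Λ p p = 1) (hne : ∀ p q, Λ p q ≠ 0)
    (htri : ∀ p q r, p ≠ q → p ≠ r → q ≠ r → Λ q r ≠ Λ q p * Λ p r)
    (hL : ∀ p, L p = 1 - (1 - t) • vecMulVec (Pi.single p 1) (Λ p))
    (hL' : ∀ p, L' p = 1 - (1 - t⁻¹) • vecMulVec (Pi.single p 1) (Λ p))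
    (hT : ∀ p, ∀ Y ∈ T, L p * Y * L' p ∈ T) {Y : Matrix n n ℂ} (hY : Y ∈ T)
    (hYs : ∀ a : ℂ, Y ≠ a • 1) {i j : n} (hij : i ≠ j) : Matrix.single i j 1 ∈ T := by
  have hP : ∀ p, vecMulVec (Pi.single p 1) (Λ p) * vecMulVec (Pi.single p 1) (Λ p) =
      vecMulVec (Pi.single p 1) (Λ p) := by
    intro p
    rw [vecMulVec_mul_vecMulVec]
    simp [hdiag]
  have hW : ∀ p, ∀ Z ∈ T, vecMulVec (Pi.single p 1) (Λ p ᵥ* (Z * (1 -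
      vecMulVec (Pi.single p 1) (Λ p)))) ∈ T := by
    intro p Z hZ
    rw [← vecMulVec_mul, ← mul_assoc]
    exact mul_mul_one_sub_mem_of_conj_mem ht0 ht (hP p) (hL p) (hL' p) (hT p) hZ
  have hproj : ∀ p (ψ : n → ℂ), ψ ᵥ* (1 - vecMulVec (Pi.single p 1) (Λ p)) = ψ - ψ p • Λ p := by
    intro p ψ
    rw [vecMul_sub, vecMul_one, vecMul_vecMulVec]
    simp
  -- Passing from the rank one elements with image `e_p` to those with image `e_q`.
  have step : ∀ p q (ψ : n → ℂ), vecMulVec (Pi.single p 1) ψ ∈ T →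
      vecMulVec (Pi.single q 1) (ψ - ψ q • Λ q) ∈ T := by
    intro p q ψ hψ
    have := hW q _ hψ
    rw [vecMulVec_mul, vecMul_vecMulVec, hproj, vecMulVec_smul] at this
    rw [← T.smul_mem_iff (hne q p)]
    simpa using this
  have step2 : ∀ p q (ψ : n → ℂ), ψ p = 0 → ψ q ≠ 0 → vecMulVec (Pi.single p 1) ψ ∈ T →
      vecMulVec (Pi.single p 1) (Λ q - Λ q p • Λ p) ∈ T := by
    intro p q ψ hp hq hψ
    have h1 := T.sub_mem hψ (step q p _ (step p q ψ hψ))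
    rw [← vecMulVec_sub] at h1
    rw [← T.smul_mem_iff hq, ← vecMulVec_smul]
    have h2 : ψ q • (Λ q - Λ q p • Λ p) =
        ψ - (ψ - ψ q • Λ q - (ψ - ψ q • Λ q) p • Λ p) := by
      ext r
      simp only [Pi.sub_apply, Pi.smul_apply, smul_eq_mul, hp]
      ring
    rwa [h2]
  -- If some nonzero linear form occurs at `p`, then all linear forms vanishing at `e_p` do.
  have full : ∀ p (ψ : n → ℂ), ψ p = 0 → ψ ≠ 0 → vecMulVec (Pi.single p 1) ψ ∈ T →
      ∀ φ : n → ℂ, φ p = 0 → vecMulVec (Pi.single p 1) φ ∈ T := by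
    intro p ψ hp hψ0 hψ φ hφ
    obtain ⟨q, hq⟩ := Function.ne_iff.1 hψ0
    have hq' : ψ q ≠ 0 := hq
    have hqp : p ≠ q := fun h => hq' (h ▸ hp)
    have h1 := step2 p q ψ hp hq' hψ
    have h2 : ∀ r, vecMulVec (Pi.single p 1) (Λ r - Λ r p • Λ p) ∈ T := by
      intro r
      by_cases hrp : r = p
      · simp [hrp, hdiag]
      by_cases hrq : r = q
      · rw [hrq]; exact h1
      refine step2 p r _ (by simp [hdiag]) ?_ h1
      simpa [sub_eq_zero] using htri p q r hqp (Ne.symm hrp) (Ne.symm hrq)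
    have h3 : φ = ∑ r, (φ ᵥ* Λ⁻¹) r • (Λ r - Λ r p • Λ p) := by
      have h4 : (φ ᵥ* Λ⁻¹) ᵥ* Λ = φ := by
        rw [vecMul_vecMul, nonsing_inv_mul _ hΛ, vecMul_one]
      have h5 : ∀ k, ∑ r, (φ ᵥ* Λ⁻¹) r * Λ r k = φ k := fun k => congrFun h4 k
      ext k
      simp only [Finset.sum_apply, Pi.smul_apply, Pi.sub_apply, smul_eq_mul, mul_sub,
        Finset.sum_sub_distrib, ← mul_assoc, ← Finset.sum_mul, h5, hφ]
      ring
    have h6 : vecMulVec (Pi.single p 1) φ =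
        ∑ r, (φ ᵥ* Λ⁻¹) r • vecMulVec (Pi.single p 1) (Λ r - Λ r p • Λ p) := by
      conv_lhs => rw [h3]
      ext a b
      simp [vecMulVec_apply, Matrix.sum_apply, Finset.mul_sum, mul_left_comm]
    rw [h6]
    exact T.sum_mem fun r _ => T.smul_mem _ (h2 r)
  -- Some nonzero linear form occurs, since otherwise all elements of `T` are scalar.
  have exist : ∃ p, ∃ ψ : n → ℂ, ψ p = 0 ∧ ψ ≠ 0 ∧ vecMulVec (Pi.single p 1) ψ ∈ T := by
    by_contra! hcon
    have hrow : ∀ p, ∀ Z ∈ T, ∃ a : ℂ, Λ p ᵥ* Z = a • Λ p := by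
      intro p Z hZ
      have h1 := hW p Z hZ
      rw [← vecMul_vecMul, hproj] at h1
      refine ⟨(Λ p ᵥ* Z) p, ?_⟩
      by_contra h2
      exact hcon p _ (by simp [hdiag]) (sub_ne_zero.2 h2) h1
    have hinv : ∀ p, Λ p ᵥ* Λ⁻¹ = Pi.single p 1 := by
      intro p
      have : (Λ * Λ⁻¹) p = Pi.single p 1 := by
        rw [mul_nonsing_inv _ hΛ]
        ext r; simp [Matrix.one_apply, Pi.single_apply, eq_comm]
      rw [← this]; rfl
    choose a ha using fun p => hrow p Y hY
    have hconst : ∀ p q, a p = a q := by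
      intro p q
      by_cases hpq : p = q
      · rw [hpq]
      obtain ⟨b, hb⟩ := hrow p _ (hT q Y hY)
      have hLL : L' q * L q = 1 := by
        have hP' := hP q
        rw [hL, hL']
        simp only [sub_mul, mul_sub, one_mul, mul_one, Matrix.smul_mul, Matrix.mul_smul, hP',
          smul_smul]
        match_scalars
        · ring
        · field_simp
          ring
      have h1 : (Λ p ᵥ* L q) ᵥ* Y = b • (Λ p ᵥ* L q) := by
        rw [← smul_vecMul, ← hb, vecMul_vecMul, vecMul_vecMul, mul_assoc _ (L' q), hLL, mul_one]
      have h2 : Λ p ᵥ* L q = Λ p - ((1 - t) * Λ p q) • Λ q := by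
        rw [hL, vecMul_sub, vecMul_one, vecMul_smul, vecMul_vecMulVec]
        simp [smul_smul]
      rw [h2, sub_vecMul, smul_vecMul, ha, ha] at h1
      have h3 := congrArg (fun x => x ᵥ* Λ⁻¹) h1
      simp only [sub_vecMul, smul_vecMul, hinv, smul_sub] at h3
      have h4 := congrFun h3 p
      have h5 := congrFun h3 q
      simp [hpq, Ne.symm hpq] at h4 h5
      have h1t : 1 - t ≠ 0 := fun h => ht (by rw [← sub_eq_zero.1 h]; ring)
      have h6 : (1 - t) * Λ p q ≠ 0 := mul_ne_zero h1t (hne p q)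
      rw [h4]
      refine (mul_left_cancel₀ h6 ?_).symm
      linear_combination h5
    refine hYs (a i) ?_
    have h1 : Λ * Y = Λ * (a i • 1) := by
      ext1 p q
      have := congrFun (ha p) q
      rw [hconst p i] at this
      have h3 : (Λ * Y) p q = (Λ p ᵥ* Y) q := rfl
      simpa [h3] using this
    have h2 := congrArg (fun Z => Λ⁻¹ * Z) h1
    simpa [← mul_assoc, nonsing_inv_mul _ hΛ] using h2
  obtain ⟨p, ψ, hp, hψ0, hψ⟩ := exist
  have hi : vecMulVec (Pi.single i 1) (Pi.single j 1) ∈ T := by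
    refine full i (ψ - ψ i • Λ i) (by simp [hdiag]) (fun h0 => hψ0 ?_) (step p i ψ hψ) _
      (by simp [hij])
    have h1 : ψ = ψ i • Λ i := sub_eq_zero.1 h0
    have h2 := congrFun h1 p
    rw [hp, Pi.smul_apply, smul_eq_mul, eq_comm, mul_eq_zero] at h2
    rw [h1, h2.resolve_right (hne i p), zero_smul]
  rwa [← single_eq_single_vecMulVec_single] at hi

end LinearAlgebra

/-! ### The hermitian form and the complex reflections -/

section Form

variable {α : ℝ} {d : ℕ}

theorem rho_eq (α : ℝ) : rho α = Complex.exp ((2 * Real.pi * α : ℝ) * Complex.I) := by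
  rw [rho]
  congr 1
  push_cast
  ring

theorem conj_rho (α : ℝ) : (starRingEnd ℂ) (rho α) = zeta α := by
  rw [zeta, rho_eq, ← Complex.exp_conj, ← Complex.exp_neg, map_mul, Complex.conj_I,
    Complex.conj_ofReal, mul_neg]

theorem conj_zeta (α : ℝ) : (starRingEnd ℂ) (zeta α) = rho α := by
  rw [← conj_rho, Complex.conj_conj]

theorem zeta_im (α : ℝ) : (zeta α).im = -Real.sin (2 * Real.pi * α) := by
  rw [← conj_rho, Complex.conj_im, rho_eq, Complex.exp_ofReal_mul_I_im]

theorem zeta_im_ne_zero (h0 : 0 < α) (h1 : α < 1 / 2) : (zeta α).im ≠ 0 := by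
  rw [zeta_im, neg_ne_zero]
  refine (Real.sin_pos_of_pos_of_lt_pi (by positivity) ?_).ne'
  nlinarith [Real.pi_pos]

theorem one_add_zeta_ne_zero (h0 : 0 < α) (h1 : α < 1 / 2) : 1 + zeta α ≠ 0 := fun h =>
  zeta_im_ne_zero h0 h1 (by rw [← add_eq_zero_iff_neg_eq.1 h]; simp)

theorem zeta_sq_ne_one (h0 : 0 < α) (h1 : α < 1 / 2) : zeta α ^ 2 ≠ 1 := fun h =>
  zeta_im_ne_zero h0 h1 (by
    rcases eq_or_eq_neg_of_sq_eq_sq _ _ (h.trans (one_pow 2).symm) with h | h <;> simp [h])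

theorem zeta_ne_zero (α : ℝ) : zeta α ≠ 0 := right_ne_zero_of_mul_eq_one (rho_mul_zeta α)

theorem zeta_inv (α : ℝ) : (zeta α)⁻¹ = rho α := by rw [zeta, inv_inv]

theorem gram_self (p : Fin d) : gram α p p = 1 := by simp [gram]

theorem gram_of_gt {p q : Fin d} (h : q < p) : gram α p q = (1 + zeta α)⁻¹ := by
  simp [gram, h, h.ne']

theorem gram_of_lt {p q : Fin d} (h : p < q) : gram α p q = (1 + rho α)⁻¹ := by
  simp [gram, h.not_gt, h.ne, conj_zeta]

theorem conj_gram (p q : Fin d) : (starRingEnd ℂ) (gram α p q) = gram α q p := by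
  rcases lt_trichotomy p q with h | h | h
  · rw [gram_of_lt h, gram_of_gt h, map_inv₀, map_add, map_one, conj_rho]
  · rw [h, gram_self, map_one]
  · rw [gram_of_lt h, gram_of_gt h, map_inv₀, map_add, map_one, conj_zeta]

theorem one_add_rho_ne_zero (h0 : 0 < α) (h1 : α < 1 / 2) : 1 + rho α ≠ 0 := by
  have := one_add_zeta_ne_zero h0 h1
  rw [← conj_zeta, ← map_one (starRingEnd ℂ), ← map_add]
  exact (map_ne_zero _).2 this

/-- With `c = (1 + ζ)⁻¹`, the relation `c + conj c = 1`. -/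
theorem inv_one_add_rho (h0 : 0 < α) (h1 : α < 1 / 2) :
    (1 + rho α)⁻¹ = 1 - (1 + zeta α)⁻¹ := by
  have h2 := one_add_zeta_ne_zero h0 h1
  have h3 := one_add_rho_ne_zero h0 h1
  field_simp
  linear_combination -rho_mul_zeta α

theorem gram_ne_zero (h0 : 0 < α) (h1 : α < 1 / 2) (p q : Fin d) : gram α p q ≠ 0 := by
  rcases lt_trichotomy p q with h | h | h
  · rw [gram_of_lt h]; exact inv_ne_zero (one_add_rho_ne_zero h0 h1)
  · rw [h, gram_self]; exact one_ne_zero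
  · rw [gram_of_gt h]; exact inv_ne_zero (one_add_zeta_ne_zero h0 h1)

/-- The numbers `c = (1 + ζ)⁻¹` and `conj c = 1 - c` are different from `c ^ 2`, `c * conj c` and
`conj c ^ 2`, because `c` is not real and has real part `1 / 2`. -/
theorem gram_ne_gram_mul_gram (h0 : 0 < α) (h1 : α < 1 / 2) {p q r : Fin d} (hpq : p ≠ q)
    (hpr : p ≠ r) (hqr : q ≠ r) : gram α r q ≠ gram α p q * gram α r p := by
  have hre : (1 + zeta α)⁻¹.re = 1 / 2 := by
    have h2 : (starRingEnd ℂ) (1 + zeta α)⁻¹ = 1 - (1 + zeta α)⁻¹ := by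
      rw [map_inv₀, map_add, map_one, conj_zeta, inv_one_add_rho h0 h1]
    have h3 := congrArg Complex.re h2
    simp only [Complex.conj_re, Complex.sub_re, Complex.one_re] at h3
    linarith
  have hg : ∀ p q : Fin d, p ≠ q → (gram α p q).re = 1 / 2 ∧ ((gram α p q).im =
      (1 + zeta α)⁻¹.im ∨ (gram α p q).im = -(1 + zeta α)⁻¹.im) := by
    intro p q h
    rcases lt_or_gt_of_ne h with h | h
    · rw [gram_of_lt h, inv_one_add_rho h0 h1]
      refine ⟨?_, Or.inr (by simp)⟩
      rw [Complex.sub_re, hre, Complex.one_re]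
      norm_num
    · rw [gram_of_gt h]
      exact ⟨hre, Or.inl rfl⟩
  have him : (1 + zeta α)⁻¹.im ≠ 0 := by
    rw [Complex.inv_im]
    refine div_ne_zero ?_ (by simpa using one_add_zeta_ne_zero h0 h1)
    simpa using zeta_im_ne_zero h0 h1
  intro h
  obtain ⟨r1, i1⟩ := hg r q hqr.symm
  obtain ⟨r2, i2⟩ := hg p q hpq
  obtain ⟨r3, i3⟩ := hg r p hpr.symm
  have hR := congrArg Complex.re h
  have hI := congrArg Complex.im h
  rw [Complex.mul_re, r1, r2, r3] at hR
  rw [Complex.mul_im, r2, r3] at hI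
  have hy := mul_self_pos.2 him
  rcases i1 with i1 | i1 <;> rcases i2 with i2 | i2 <;> rcases i3 with i3 | i3 <;>
    rw [i2, i3] at hR <;> rw [i1, i2, i3] at hI <;>
    exact him (by linarith)

theorem form_eq_sum_dual (x y : Fin d → ℂ) :
    form α x y = ∑ p, x p * ∑ q, (starRingEnd ℂ) (y q) * gram α p q := by
  simp only [form, Finset.mul_sum, mul_assoc]

theorem form_add_left (x y z : Fin d → ℂ) : form α (x + y) z = form α x z + form α y z := by
  simp only [form_eq_sum_dual, Pi.add_apply, add_mul, Finset.sum_add_distrib]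

theorem form_smul_left (a : ℂ) (x z : Fin d → ℂ) : form α (a • x) z = a * form α x z := by
  simp only [form_eq_sum_dual, Pi.smul_apply, smul_eq_mul, mul_assoc, ← Finset.mul_sum]

theorem form_sub_left (x y z : Fin d → ℂ) : form α (x - y) z = form α x z - form α y z := by
  rw [sub_eq_add_neg, ← neg_one_smul ℂ y, form_add_left, form_smul_left]
  ring

theorem conj_form (x y : Fin d → ℂ) : (starRingEnd ℂ) (form α x y) = form α y x := by
  simp only [form, map_sum, map_mul, Complex.conj_conj, conj_gram]
  rw [Finset.sum_comm]
  refine Finset.sum_congr rfl fun p _ => Finset.sum_congr rfl fun q _ => ?_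
  ring

theorem form_sub_right (x y z : Fin d → ℂ) : form α x (y - z) = form α x y - form α x z := by
  rw [← conj_form, form_sub_left, map_sub, conj_form, conj_form]

theorem form_smul_right (a : ℂ) (x z : Fin d → ℂ) :
    form α x (a • z) = (starRingEnd ℂ) a * form α x z := by
  rw [← conj_form, form_smul_left, map_mul, conj_form]

theorem form_sum_left {ι : Type*} (s : Finset ι) (x : ι → Fin d → ℂ) (y : Fin d → ℂ) :
    form α (∑ i ∈ s, x i) y = ∑ i ∈ s, form α (x i) y := by
  classical
  induction s using Finset.induction_on with
  | empty => simp [form]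
  | insert i s hi ih => rw [Finset.sum_insert hi, Finset.sum_insert hi, form_add_left, ih]

theorem form_e_e (p q : Fin d) : form α (e p) (e q) = gram α p q := by
  simp [form, e, Pi.single_apply]

/-- The linear form `x ↦ Q_α (x, v)`, as a row vector. -/
noncomputable def dual (α : ℝ) {d : ℕ} (v : Fin d → ℂ) : Fin d → ℂ := fun q => form α (e q) v

theorem dual_dotProduct (x v : Fin d → ℂ) : dual α v ⬝ᵥ x = form α x v := by
  have h : x = ∑ q, x q • e q := by
    ext i; simp [e, Pi.single_apply]
  conv_rhs => rw [h]
  rw [form_sum_left, dotProduct]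
  refine Finset.sum_congr rfl fun q _ => ?_
  rw [form_smul_left, dual, mul_comm]

theorem dual_e (p : Fin d) : dual α (e p) = fun q => gram α q p := by
  ext q; rw [dual, form_e_e]

/-- The operator `x ↦ Q_α (x, v) v`. -/
noncomputable def proj (α : ℝ) {d : ℕ} (v : Fin d → ℂ) : Matrix (Fin d) (Fin d) ℂ :=
  vecMulVec v (dual α v)

theorem proj_mulVec (v x : Fin d → ℂ) : proj α v *ᵥ x = form α x v • v := by
  rw [proj, vecMulVec_mulVec, dual_dotProduct]
  ext i; simp [mul_comm]

theorem proj_mul_proj (v w : Fin d → ℂ) :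
    proj α v * proj α w = form α w v • vecMulVec v (dual α w) := by
  rw [proj, proj, vecMulVec_mul_vecMulVec, dual_dotProduct, vecMulVec_smul]

theorem proj_mul_self {v : Fin d → ℂ} (h : form α v v = 1) : proj α v * proj α v = proj α v := by
  rw [proj_mul_proj, h, one_smul, proj]

theorem proj_mul_proj_mul_proj (v w : Fin d → ℂ) :
    proj α v * proj α w * proj α v = (form α v w * form α w v) • proj α v := by
  rw [proj_mul_proj, proj, Matrix.smul_mul, vecMulVec_mul_vecMulVec, dual_dotProduct,
    vecMulVec_smul, smul_smul, mul_comm]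

/-- The operator `L_p` is the complex reflection in the unit vector `e_p` with eigenvalue `-ζ`. -/
theorem op_val (h0 : 0 < α) (h1 : α < 1 / 2) (p : Fin d) :
    (op α p).1 = 1 - (1 + zeta α) • proj α (e p) := by
  have h2 := one_add_zeta_ne_zero h0 h1
  have h3 := one_add_rho_ne_zero h0 h1
  have h4 : (1 + zeta α) * (1 + rho α)⁻¹ = zeta α := by
    field_simp
    linear_combination -zeta_mul_rho α
  ext i q
  change opCol α p q i = _
  rw [opCol_eq]
  rw [proj, dual_e]
  simp only [Matrix.sub_apply, Matrix.smul_apply, vecMulVec_apply, e, Pi.sub_apply,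
    Pi.smul_apply, smul_eq_mul, Pi.single_apply, Matrix.one_apply]
  rcases lt_trichotomy p q with h | h | h
  · simp [h, gram_of_gt h, h2]
  · simp [h, gram_self]
  · simp [h, h.not_gt, gram_of_lt h, h4]

theorem op_inv_val (h0 : 0 < α) (h1 : α < 1 / 2) (p : Fin d) :
    (op α p)⁻¹.1 = 1 - (1 + rho α) • proj α (e p) := by
  have h2 := one_add_zeta_ne_zero h0 h1
  have h3 := one_add_rho_ne_zero h0 h1
  have h4 : (1 + rho α) * (1 + zeta α)⁻¹ = rho α := by
    field_simp
    linear_combination -zeta_mul_rho α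
  ext i q
  change opInvCol α p q i = _
  rw [opInvCol_eq]
  rw [proj, dual_e]
  simp only [Matrix.sub_apply, Matrix.smul_apply, vecMulVec_apply, e, Pi.sub_apply,
    Pi.smul_apply, smul_eq_mul, Pi.single_apply, Matrix.one_apply]
  rcases lt_trichotomy q p with h | h | h
  · simp [h, gram_of_lt h, h3]
  · simp [h, gram_self]
  · simp [h, h.not_gt, gram_of_gt h, h4]

theorem op_mem_U (h0 : 0 < α) (h1 : α < 1 / 2) (p : Fin d) : op α p ∈ U α d := by
  intro x y
  rw [op_val h0 h1, sub_mulVec, sub_mulVec, one_mulVec, one_mulVec, smul_mulVec, smul_mulVec,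
    proj_mulVec, proj_mulVec]
  simp only [form_sub_left, form_sub_right, form_smul_left, form_smul_right, conj_form, form_e_e,
    gram_self, map_add, map_one, conj_zeta]
  linear_combination (form α x (e p) * form α (e p) y) * (rho_mul_zeta α)

theorem opGroup_le_U (h0 : 0 < α) (h1 : α < 1 / 2) (d : ℕ) : opGroup α d ≤ U α d := by
  rw [opGroup, Subgroup.closure_le]
  rintro _ ⟨p, rfl⟩
  exact op_mem_U h0 h1 p

theorem mul_proj_mul_inv {γ : GL (Fin d) ℂ} (hγ : γ ∈ U α d) (v : Fin d → ℂ) :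
    γ.1 * proj α v * (γ⁻¹).1 = proj α (γ.1 *ᵥ v) := by
  have h : ∀ x, γ.1 *ᵥ ((γ⁻¹).1 *ᵥ x) = x := by
    intro x
    rw [mulVec_mulVec, ← Units.val_mul, mul_inv_cancel, Units.val_one, one_mulVec]
  refine Matrix.ext_of_mulVec_single fun j => ?_
  rw [← mulVec_mulVec, ← mulVec_mulVec, proj_mulVec, proj_mulVec, mulVec_smul, ← hγ, h]

theorem det_one_sub_smul_proj (a : ℂ) (v : Fin d → ℂ) :
    (1 - a • proj α v).det = 1 - a * form α v v := by
  have h := det_one_add_replicateCol_mul_replicateRow (ι := Unit) ((-a) • v) (dual α v)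
  rw [dotProduct_smul, dual_dotProduct, ← vecMulVec_eq, smul_vecMulVec, neg_smul] at h
  rw [sub_eq_add_neg, proj, h, smul_eq_mul]
  ring

end Form

/-! ### Elements of infinite order -/

section Torus

variable {n : Type*} [Fintype n] [DecidableEq n]

theorem infinite_range_pow {μ : ℂ} (hμ0 : μ ≠ 0) (hμ : ∀ k : ℕ, 0 < k → μ ^ k ≠ 1) :
    (Set.range fun k : ℕ => μ ^ k).Infinite := by
  refine Set.infinite_range_of_injective (.of_lt_imp_ne fun k l hkl h => ?_)
  refine hμ (l - k) (by omega) (mul_left_cancel₀ (pow_ne_zero k hμ0) ?_)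
  rw [← pow_add, mul_one, Nat.add_sub_cancel' hkl.le]
  exact h.symm

/-- If `M ∈ N` has eigenvalues `1, μ, μ⁻¹`, is diagonalizable and `μ` is not a root of unity, then
the Zariski closure of the powers of `M` contains a one-dimensional torus, hence the tangent space
is not reduced to scalars. -/
theorem exists_mem_tangent_of_pow_ne_one {N : Subgroup (GL n ℂ)} {g : GL n ℂ} (hg : g ∈ N)
    {μ : ℂ} (hμ0 : μ ≠ 0) (hμ : ∀ k : ℕ, 0 < k → μ ^ k ≠ 1)
    (hM : (g.1 - 1) * (g.1 * g.1 - (μ + μ⁻¹) • g.1 + 1) = 0) (hs : ∀ a : ℂ, g.1 ≠ a • 1) :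
    ∃ Y ∈ tangent N, ∀ a : ℂ, Y ≠ a • 1 := by
  set M := g.1 with hMdef
  have hμ1 : μ ≠ 1 := by simpa using hμ 1 one_pos
  have hμ2 : μ ^ 2 ≠ 1 := hμ 2 two_pos
  have hμ2' : μ + 1 ≠ 0 := fun h => hμ2 (by linear_combination (μ - 1) * h)
  have hμ1' : μ - 1 ≠ 0 := sub_ne_zero.2 hμ1
  have h1 : M * M * M = (μ + μ⁻¹ + 1) • (M * M) - (μ + μ⁻¹ + 1) • M + 1 := by
    have h : M * M * M - ((μ + μ⁻¹ + 1) • (M * M) - (μ + μ⁻¹ + 1) • M + 1) =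
        (M - 1) * (M * M - (μ + μ⁻¹) • M + 1) := by
      simp only [mul_add, mul_sub, sub_mul, one_mul, mul_one, Matrix.mul_smul, mul_assoc]
      module
    rw [← sub_eq_zero, h, hM]
  -- The spectral projections for the eigenvalues `1`, `μ` and `μ⁻¹`.
  obtain ⟨A, hA⟩ : ∃ Z, Z =
      (2 - (μ + μ⁻¹))⁻¹ • (M * M - (μ + μ⁻¹) • M + 1) := ⟨_, rfl⟩
  obtain ⟨B, hB⟩ : ∃ Z, Z =
      ((μ - 1) * (μ - μ⁻¹))⁻¹ • (M * M - (1 + μ⁻¹) • M + μ⁻¹ • (1 : Matrix n n ℂ)) := ⟨_, rfl⟩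
  obtain ⟨D, hD⟩ : ∃ Z, Z =
      ((μ⁻¹ - 1) * (μ⁻¹ - μ))⁻¹ • (M * M - (1 + μ) • M + μ • (1 : Matrix n n ℂ)) := ⟨_, rfl⟩
  have d1 : 2 - (μ + μ⁻¹) ≠ 0 := fun h => by
    field_simp at h
    exact pow_ne_zero 2 hμ1' (by linear_combination -h)
  have d2 : μ - μ⁻¹ ≠ 0 := fun h => by
    field_simp at h
    exact hμ2 (by linear_combination h)
  have d3 : μ⁻¹ - 1 ≠ 0 := fun h => hμ1 (by field_simp at h; linear_combination -h)
  have d4 : μ⁻¹ - μ ≠ 0 := fun h => d2 (by linear_combination -h)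
  have d12 := mul_ne_zero hμ1' d2
  have d34 := mul_ne_zero d3 d4
  have hsum : A + B + D = 1 := by
    have e1 : (2 - (μ + μ⁻¹))⁻¹ = - μ / (μ - 1) ^ 2 := by
      rw [inv_eq_iff_eq_inv, inv_div]; field_simp; ring
    have e2 : ((μ - 1) * (μ - μ⁻¹))⁻¹ = μ / ((μ - 1) ^ 2 * (μ + 1)) := by
      rw [inv_eq_iff_eq_inv, inv_div]; field_simp; ring
    have e3 : ((μ⁻¹ - 1) * (μ⁻¹ - μ))⁻¹ = μ ^ 2 / ((μ - 1) ^ 2 * (μ + 1)) := by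
      rw [inv_eq_iff_eq_inv, inv_div]; field_simp; ring
    rw [hA, hB, hD, e1, e2, e3]
    match_scalars <;> field_simp <;> ring
  have hMA : M * A = A := by
    rw [hA, Matrix.mul_smul]
    congr 1
    rw [mul_add, mul_sub, Matrix.mul_smul, ← mul_assoc, h1, mul_one]
    module
  have hMB : M * B = μ • B := by
    rw [hB, Matrix.mul_smul, smul_comm]
    congr 1
    rw [mul_add, mul_sub, Matrix.mul_smul, Matrix.mul_smul, ← mul_assoc, h1, mul_one]
    match_scalars <;> field_simp <;> ring
  have hMD : M * D = μ⁻¹ • D := by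
    rw [hD, Matrix.mul_smul, smul_comm]
    congr 1
    rw [mul_add, mul_sub, Matrix.mul_smul, Matrix.mul_smul, ← mul_assoc, h1, mul_one]
    match_scalars <;> field_simp <;> ring
  have hpow : ∀ k : ℕ, M ^ k = A + (μ ^ k) • B + (μ ^ k)⁻¹ • D := by
    intro k
    induction k with
    | zero => simp [hsum]
    | succ k ih =>
      rw [pow_succ', ih, mul_add, mul_add, Matrix.mul_smul, Matrix.mul_smul, hMA, hMB, hMD,
        smul_smul, smul_smul, pow_succ, mul_inv]
  refine ⟨B - D, sub_mem_tangent hsum (S := Set.range fun k : ℕ => μ ^ k) ?_ ?_, ?_⟩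
  · exact infinite_range_pow hμ0 hμ
  · rintro _ ⟨k, rfl⟩ _
    have := subset_zclosure (pow_mem hg k)
    rwa [Units.val_pow_eq_pow_val, ← hMdef, hpow k] at this
  · intro a ha
    have hMexp : M = A + μ • B + μ⁻¹ • D := by simpa using hpow 1
    have hB' : B = a • 1 + D := by rw [← ha]; abel
    -- `(M - μ) B = 0` and `(M - μ⁻¹) D = 0` force `a = 0` or `A = 0`.
    have e1 : (μ - μ⁻¹) • D = a • (M - μ • (1 : Matrix n n ℂ)) := by
      have := hMB
      rw [hB', mul_add, hMD, Matrix.mul_smul, mul_one] at this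
      rw [smul_sub, eq_sub_of_add_eq this]
      module
    have e2 : a • (M * M - (μ + μ⁻¹) • M + 1) = 0 := by
      have h2 : M * ((μ - μ⁻¹) • D) = μ⁻¹ • ((μ - μ⁻¹) • D) := by
        rw [Matrix.mul_smul, hMD, smul_comm]
      rw [e1, Matrix.mul_smul, mul_sub, Matrix.mul_smul, mul_one, ← sub_eq_zero] at h2
      rw [← h2]
      match_scalars <;> field_simp
      ring
    have e3 : a • A = 0 := by rw [hA, smul_comm, e2, smul_zero]
    rcases smul_eq_zero.1 e3 with h | h
    · rw [h, zero_smul, smul_eq_zero] at e1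
      have hD0 := e1.resolve_left d2
      rw [h, zero_smul, zero_add, hD0] at hB'
      rw [hB', hD0, add_zero, add_zero] at hsum
      exact hs 1 (by rw [hMexp, hB', hD0, hsum]; simp)
    · rw [h, zero_add, hB'] at hsum
      have hD2 : D = ((1 - a) / 2) • 1 := by
        have : D = (2 : ℂ)⁻¹ • (a • 1 + D + D - a • (1 : Matrix n n ℂ)) := by module
        rw [this, hsum]
        module
      refine hs (μ * (a + (1 - a) / 2) + μ⁻¹ * ((1 - a) / 2)) ?_
      rw [hMexp, h, hB', hD2]
      module

end Torus

/-! ### Products of two complex reflections -/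

section TwoReflections

/-- If `P` and `Q` are rank one projections with `tr (P Q) = s`, the product `M` of the complex
reflections `1 - (1 - t) P` and `1 - (1 - t⁻¹) Q` is the identity modulo a plane, where it has
determinant `1` and trace `τ = t + t⁻¹ + (1 - t) (1 - t⁻¹) s`. This identity expresses it by the
relations between `P` and `Q` alone. -/
theorem sub_one_mul_eq_zero {R : Type*} [Ring R] [Algebra ℂ R] {P Q : R} {t s : ℂ}
    (ht : t ≠ 0) (hP : P * P = P) (hQ : Q * Q = Q) (hPQ : P * Q * P = s • P)
    (hQP : Q * P * Q = s • Q) {M : R} (hM : M = (1 - (1 - t) • P) * (1 - (1 - t⁻¹) • Q)) :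
    (M - 1) * (M * M - (t + t⁻¹ + (1 - t) * (1 - t⁻¹) * s) • M + 1) = 0 := by
  have hM' : M = 1 - (1 - t) • P - (1 - t⁻¹) • Q + ((1 - t) * (1 - t⁻¹)) • (P * Q) := by
    rw [hM]
    simp only [mul_sub, sub_mul, mul_one, one_mul, smul_mul_smul_comm]
    abel
  have hPM : P * M = t • P - (t * (1 - t⁻¹)) • (P * Q) := by
    rw [hM']
    simp only [mul_add, mul_sub, mul_one, mul_smul_comm, ← mul_assoc, hP]
    module
  have hQM : Q * M = (t⁻¹ + (1 - t) * (1 - t⁻¹) * s) • Q - (1 - t) • (Q * P) := by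
    rw [hM']
    simp only [mul_add, mul_sub, mul_one, mul_smul_comm, ← mul_assoc, hQ, hQP]
    module
  have h1 : P * (M * M - (t + t⁻¹ + (1 - t) * (1 - t⁻¹) * s) • M + 1) = 0 := by
    have hPMM : P * M * M = t • (P * M) - (t * (1 - t⁻¹)) • (P * (Q * M)) := by
      rw [hPM, sub_mul, smul_mul_assoc, smul_mul_assoc, hPM, mul_assoc P Q M]
    have hPQM : P * (Q * M) =
        (t⁻¹ + (1 - t) * (1 - t⁻¹) * s) • (P * Q) - ((1 - t) * s) • P := by
      rw [hQM, mul_sub, mul_smul_comm, mul_smul_comm, ← mul_assoc, hPQ, smul_smul]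
    rw [mul_add, mul_sub, mul_smul_comm, ← mul_assoc, hPMM, hPQM, hPM, mul_one]
    match_scalars <;> field_simp <;> ring
  have h2 : Q * (M * M - (t + t⁻¹ + (1 - t) * (1 - t⁻¹) * s) • M + 1) = 0 := by
    have hQMM : Q * M * M = (t⁻¹ + (1 - t) * (1 - t⁻¹) * s) • (Q * M) -
        (1 - t) • (Q * (P * M)) := by
      rw [hQM, sub_mul, smul_mul_assoc, smul_mul_assoc, hQM, mul_assoc Q P M]
    have hQPM : Q * (P * M) = t • (Q * P) - (t * (1 - t⁻¹) * s) • Q := by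
      rw [hPM, mul_sub, mul_smul_comm, mul_smul_comm, ← mul_assoc, hQP, smul_smul]
    rw [mul_add, mul_sub, mul_smul_comm, ← mul_assoc, hQMM, hQPM, hQM, mul_one]
    match_scalars <;> field_simp <;> ring
  have h3 : M - 1 = ((1 - t) * (1 - t⁻¹)) • (P * Q) - (1 - t) • P - (1 - t⁻¹) • Q := by
    rw [hM']; abel
  rw [h3, sub_mul, sub_mul, smul_mul_assoc, smul_mul_assoc, smul_mul_assoc, mul_assoc P, h1, h2]
  simp

theorem mul_sub_smul_ne_smul_one {R : Type*} [Ring R] [Algebra ℂ R] {P Q : R} {t s : ℂ}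
    (ht : t ≠ 0) (ht1 : t ≠ 1) (hP : P * P = P) (hQ : Q * Q = Q) (hPQ : P * Q * P = s • P)
    (hP0 : P ≠ 0) (hs0 : s ≠ 0) (hs1 : s ≠ 1) (m : ℂ) :
    (1 - (1 - t) • P) * (1 - (1 - t⁻¹) • Q) ≠ m • (1 : R) := by
  intro h
  have hPM : P * ((1 - (1 - t) • P) * (1 - (1 - t⁻¹) • Q)) =
      t • P - (t * (1 - t⁻¹)) • (P * Q) := by
    simp only [mul_sub, sub_mul, mul_one, one_mul, mul_smul_comm, smul_mul_assoc, ← mul_assoc, hP]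
    module
  rw [h, mul_smul_comm, mul_one] at hPM
  have hb : t * (1 - t⁻¹) ≠ 0 :=
    mul_ne_zero ht (sub_ne_zero.2 fun h => ht1 (by rw [← inv_inv t, ← h, inv_one]))
  -- `P Q` is proportional to `P`, hence idempotent up to the factor `s`.
  obtain ⟨k, hk⟩ : ∃ k : ℂ, P * Q = k • P := by
    refine ⟨(t * (1 - t⁻¹))⁻¹ * (t - m), ?_⟩
    have : (t * (1 - t⁻¹)) • (P * Q) = (t - m) • P := by
      rw [sub_smul, hPM]; abel
    rw [mul_smul, ← this, smul_smul, inv_mul_cancel₀ hb, one_smul]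
  have hks : k = s := by
    rw [hk, smul_mul_assoc, hP] at hPQ
    exact smul_left_injective ℂ hP0 hPQ
  have h2 : P * Q * Q = P * Q := by rw [mul_assoc, hQ]
  rw [hk, smul_mul_assoc, hk, smul_smul] at h2
  have h3 : k * k = k := smul_left_injective ℂ hP0 h2
  rw [hks] at h3
  exact hs1 (mul_left_cancel₀ hs0 (by rw [h3, mul_one]))

end TwoReflections

/-! ### Galois conjugates and roots of unity -/

section RootsOfUnity

open Polynomial

/-- A number `G (t) = μ + μ⁻¹`, for an integral polynomial `G` and a root of unity `t`, that has a
real Galois conjugate `G (t') > 2`, is such that `μ` is not a root of unity. -/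
theorem pow_ne_one_of_two_lt {n : ℕ} (hn : 0 < n) {t t' μ : ℂ} (ht : IsPrimitiveRoot t n)
    (ht' : IsPrimitiveRoot t' n) (G : ℤ[X]) {x : ℝ} (hx : 2 < x) (hG' : aeval t' G = x)
    (hμ0 : μ ≠ 0) (hG : aeval t G = μ + μ⁻¹) (k : ℕ) (hk : 0 < k) : μ ^ k ≠ 1 := by
  intro h
  -- The Dickson polynomial of index `k` takes the value `μ ^ k + μ⁻¹ ^ k` at `μ + μ⁻¹`.
  have hmap : ∀ z : ℂ, aeval z ((dickson 1 (1 : ℤ) k).comp G - 2) =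
      (dickson 1 (1 : ℂ) k).eval (aeval z G) - 2 := by
    intro z
    rw [map_sub, aeval_comp, map_ofNat, aeval_def, eval₂_eq_eval_map, map_dickson]
    simp
  have h1 : aeval t ((dickson 1 (1 : ℤ) k).comp G - 2) = 0 := by
    rw [hmap, hG, dickson_one_one_eval_add_inv _ _ (mul_inv_cancel₀ hμ0), inv_pow, h]
    norm_num
  have h2 : aeval t' ((dickson 1 (1 : ℤ) k).comp G - 2) = 0 := by
    refine aeval_eq_zero_of_dvd_aeval_eq_zero
      (minpoly.isIntegrallyClosed_dvd (ht.isIntegral hn) h1) ?_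
    rw [← cyclotomic_eq_minpoly ht hn, cyclotomic_eq_minpoly ht' hn]
    exact minpoly.aeval _ _
  obtain ⟨ν, hν1, hν⟩ : ∃ ν : ℝ, 1 < ν ∧ ν + ν⁻¹ = x := by
    have h4 : 0 < x ^ 2 - 4 := by nlinarith
    have h5 := Real.sq_sqrt h4.le
    have h6 := Real.sqrt_nonneg (x ^ 2 - 4)
    refine ⟨(x + √(x ^ 2 - 4)) / 2, by linarith, ?_⟩
    have : (x + √(x ^ 2 - 4)) / 2 ≠ 0 := by linarith
    field_simp
    linear_combination h5
  have hν0 : ν ≠ 0 := by linarith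
  rw [hmap, hG', ← hν, Complex.ofReal_add, Complex.ofReal_inv, dickson_one_one_eval_add_inv _ _
    (mul_inv_cancel₀ (Complex.ofReal_ne_zero.2 hν0))] at h2
  have h3 : ν ^ k + (ν⁻¹) ^ k - 2 = 0 := by exact_mod_cast h2
  have h4 : 1 < ν ^ k := one_lt_pow₀ hν1 hk.ne'
  rw [inv_pow] at h3
  have h5 : (ν ^ k) * (ν ^ k)⁻¹ = 1 := mul_inv_cancel₀ (by linarith)
  nlinarith

theorem exists_add_inv_eq (τ : ℂ) : ∃ μ : ℂ, μ ≠ 0 ∧ μ + μ⁻¹ = τ := by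
  obtain ⟨s, hs⟩ := IsAlgClosed.exists_pow_nat_eq (τ ^ 2 - 4) two_pos
  have h1 : (τ + s) / 2 * ((τ - s) / 2) = 1 := by linear_combination -hs / 4
  refine ⟨(τ + s) / 2, left_ne_zero_of_mul_eq_one h1, ?_⟩
  rw [inv_eq_of_mul_eq_one_right h1]
  ring

end RootsOfUnity

/-! ### Complex reflections in the group -/

section Orbit

variable {α : ℝ} {d : ℕ}

/-- The vector `v` is the image of some `e_p` under an element of the group generated by the
operators `L_p`. -/
def InOrbit (α : ℝ) {d : ℕ} (v : Fin d → ℂ) : Prop :=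
  ∃ γ ∈ opGroup α d, ∃ p, v = γ.1 *ᵥ e p

theorem inOrbit_e (p : Fin d) : InOrbit α (e p) := ⟨1, one_mem _, p, by simp⟩

theorem op_mem_opGroup (p : Fin d) : op α p ∈ opGroup α d :=
  Subgroup.subset_closure ⟨p, rfl⟩

theorem InOrbit.mulVec {v : Fin d → ℂ} (hv : InOrbit α v) {γ : GL (Fin d) ℂ}
    (hγ : γ ∈ opGroup α d) : InOrbit α (γ.1 *ᵥ v) := by
  obtain ⟨δ, hδ, p, rfl⟩ := hv
  exact ⟨γ * δ, mul_mem hγ hδ, p, by rw [Units.val_mul, mulVec_mulVec]⟩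

theorem op_mulVec (h0 : 0 < α) (h1 : α < 1 / 2) (p : Fin d) (v : Fin d → ℂ) :
    (op α p).1 *ᵥ v = v - ((1 + zeta α) * form α v (e p)) • e p := by
  rw [op_val h0 h1, sub_mulVec, one_mulVec, smul_mulVec, proj_mulVec, smul_smul]

theorem InOrbit.sub_smul (h0 : 0 < α) (h1 : α < 1 / 2) {v : Fin d → ℂ} (hv : InOrbit α v)
    (p : Fin d) : InOrbit α (v - ((1 + zeta α) * form α v (e p)) • e p) := by
  have := hv.mulVec (op_mem_opGroup p)
  rwa [op_mulVec h0 h1] at this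

theorem InOrbit.sub_smul_inv (h0 : 0 < α) (h1 : α < 1 / 2) {v : Fin d → ℂ} (hv : InOrbit α v)
    (p : Fin d) : InOrbit α (v - ((1 + rho α) * form α v (e p)) • e p) := by
  have := hv.mulVec (inv_mem (op_mem_opGroup p))
  rwa [op_inv_val h0 h1, sub_mulVec, one_mulVec, smul_mulVec, proj_mulVec, smul_smul] at this

theorem InOrbit.form_self (h0 : 0 < α) (h1 : α < 1 / 2) {v : Fin d → ℂ} (hv : InOrbit α v) :
    form α v v = 1 := by
  obtain ⟨γ, hγ, p, rfl⟩ := hv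
  rw [opGroup_le_U h0 h1 d hγ, form_e_e, gram_self]

/-- The complex reflections in the vectors of the orbit belong to the group. -/
theorem InOrbit.exists_mem_opGroup (h0 : 0 < α) (h1 : α < 1 / 2) {v : Fin d → ℂ}
    (hv : InOrbit α v) : ∃ R ∈ opGroup α d, R.1 = 1 - (1 + zeta α) • proj α v ∧
      R⁻¹.1 = 1 - (1 + rho α) • proj α v := by
  obtain ⟨γ, hγ, p, rfl⟩ := hv
  have hU := opGroup_le_U h0 h1 d hγ
  have h : γ.1 * (γ⁻¹).1 = 1 := by rw [← Units.val_mul, mul_inv_cancel, Units.val_one]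
  refine ⟨γ * op α p * γ⁻¹, mul_mem (mul_mem hγ (op_mem_opGroup p)) (inv_mem hγ), ?_, ?_⟩
  · rw [Units.val_mul, Units.val_mul, op_val h0 h1, mul_sub, sub_mul, mul_one, h, Matrix.mul_smul,
      Matrix.smul_mul, mul_proj_mul_inv hU]
  · rw [_root_.mul_inv_rev, _root_.mul_inv_rev, inv_inv, ← mul_assoc, Units.val_mul, Units.val_mul,
      op_inv_val h0 h1, mul_sub, sub_mul, mul_one, h, Matrix.mul_smul, Matrix.smul_mul,
      mul_proj_mul_inv hU]

theorem mem_SL_iff (g : GL (Fin d) ℂ) : g ∈ SL d ↔ g.1.det = 1 := by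
  rw [SL, MonoidHom.mem_ker, Units.ext_iff]
  rfl

theorem inf_SU_eq (h0 : 0 < α) (h1 : α < 1 / 2) (d : ℕ) :
    opGroup α d ⊓ SU α d = opGroup α d ⊓ SL d := by
  rw [SU, ← inf_assoc, inf_eq_left.2 (opGroup_le_U h0 h1 d)]

theorem conj_mem_inf_SU (h0 : 0 < α) (h1 : α < 1 / 2) {γ : GL (Fin d) ℂ} (hγ : γ ∈ opGroup α d) :
    ∀ h ∈ opGroup α d ⊓ SU α d, γ * h * γ⁻¹ ∈ opGroup α d ⊓ SU α d := by
  rw [inf_SU_eq h0 h1]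
  intro h hh
  exact Subgroup.mem_inf.2
    ⟨mul_mem (mul_mem hγ hh.1) (inv_mem hγ), (MonoidHom.normal_ker _).conj_mem _ hh.2 _⟩

end Orbit

/-! ### Criteria for a nonscalar tangent vector -/

section Tangent

variable {α : ℝ} {d : ℕ}

/-- If the operators `L_p` have infinite order, the Zariski closure contains the family
`C_p (s) C_q (s⁻¹)`, where `C_p (s)` is the complex reflection in `e_p` with eigenvalue `s`. Its
derivative at `s = 1` is tangent. -/
theorem exists_mem_tangent_of_infinite_order (h0 : 0 < α) (h1 : α < 1 / 2) (hd : 2 ≤ d)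
    (ht : ∀ k : ℕ, 0 < k → (-zeta α) ^ k ≠ 1) :
    ∃ Y ∈ tangent (opGroup α d ⊓ SU α d), ∀ a : ℂ, Y ≠ a • 1 := by
  set p : Fin d := ⟨0, by omega⟩ with hp
  set q : Fin d := ⟨1, by omega⟩ with hq
  have hpq : p ≠ q := by simp [hp, hq]
  set P := proj α (e p) with hP
  set Q := proj α (e q) with hQ
  have hPP : P * P = P := proj_mul_self (by rw [form_e_e, gram_self])
  have hQQ : Q * Q = Q := proj_mul_self (by rw [form_e_e, gram_self])
  have hpow : ∀ (R : Matrix (Fin d) (Fin d) ℂ) (t : ℂ), R * R = R → ∀ k : ℕ,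
      (1 - (1 - t) • R) ^ k = 1 - (1 - t ^ k) • R := by
    intro R t hR k
    induction k with
    | zero => simp
    | succ k ih =>
      rw [pow_succ, ih, pow_succ]
      simp only [mul_sub, sub_mul, mul_one, one_mul, smul_mul_smul_comm, hR]
      module
  have hsum : (1 - P) * (1 - Q) + P * Q + P * (1 - Q) + (1 - P) * Q = 1 := by noncomm_ring
  refine ⟨P * (1 - Q) - (1 - P) * Q, sub_mem_tangent hsum
    (infinite_range_pow (neg_ne_zero.2 (zeta_ne_zero α)) ht) ?_, fun a ha => ?_⟩
  · rintro _ ⟨k, rfl⟩ -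
    have hmem : op α p ^ k * (op α q)⁻¹ ^ k ∈ opGroup α d ⊓ SU α d := by
      rw [inf_SU_eq h0 h1]
      refine Subgroup.mem_inf.2
        ⟨mul_mem (pow_mem (op_mem_opGroup p) k) (pow_mem (inv_mem (op_mem_opGroup q)) k), ?_⟩
      rw [mem_SL_iff, Units.val_mul, Units.val_pow_eq_pow_val,
        Units.val_pow_eq_pow_val, op_val h0 h1, op_inv_val h0 h1, det_mul, det_pow, det_pow,
        det_one_sub_smul_proj, det_one_sub_smul_proj, form_e_e, form_e_e, gram_self, gram_self,
        ← mul_pow, show (1 - (1 + zeta α) * 1) * (1 - (1 + rho α) * 1) = 1 by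
          linear_combination zeta_mul_rho α, one_pow]
    have := subset_zclosure hmem
    rw [Units.val_mul, Units.val_pow_eq_pow_val, Units.val_pow_eq_pow_val, op_val h0 h1,
      op_inv_val h0 h1, ← sub_neg_eq_add, ← sub_neg_eq_add (1 : ℂ) (rho α), hpow _ _ hPP,
      hpow _ _ hQQ] at this
    have h2 : ((-zeta α) ^ k)⁻¹ = (-rho α) ^ k := by
      rw [← inv_pow, inv_neg, zeta_inv]
    have h3 : (-zeta α) ^ k * (-rho α) ^ k = 1 := by
      rw [← mul_pow, neg_mul_neg, zeta_mul_rho, one_pow]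
    convert this using 1
    rw [h2]
    simp only [mul_sub, sub_mul, mul_one, one_mul, smul_mul_smul_comm, smul_sub]
    rw [h3]
    module
  · have h2 : P * (1 - Q) - (1 - P) * Q = P - Q := by noncomm_ring
    rw [h2] at ha
    have h3 := congrFun (congrFun ha p) q
    simp only [hP, hQ, Matrix.sub_apply, proj, dual_e, vecMulVec_apply, Matrix.smul_apply] at h3
    simp [e, hpq] at h3
    exact gram_ne_zero h0 h1 _ _ h3

/-- The criterion used when the operators `L_p` have finite order: for `x` and `y` in the orbit, the
product of the reflection in `x` and the inverse of the reflection in `y` acts on their span with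
determinant `1` and trace `τ = G (-ζ)`; if a Galois conjugate `G (t')` of `τ` is real and larger
than `2`, this product is of infinite order. -/
theorem exists_mem_tangent_of_two_lt (h0 : 0 < α) (h1 : α < 1 / 2) {x y : Fin d → ℂ}
    (hx : InOrbit α x) (hy : InOrbit α y) {n : ℕ} (hn : 0 < n) {t' : ℂ}
    (ht : IsPrimitiveRoot (-zeta α) n) (ht' : IsPrimitiveRoot t' n) (G : Polynomial ℤ) {r : ℝ}
    (hr : 2 < r) (hG' : Polynomial.aeval t' G = r) (hxy : form α x y ≠ 0)
    (hG : Polynomial.aeval (-zeta α) G =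
      -zeta α - rho α + (1 + zeta α) * (1 + rho α) * (form α x y * form α y x)) :
    ∃ Y ∈ tangent (opGroup α d ⊓ SU α d), ∀ a : ℂ, Y ≠ a • 1 := by
  obtain ⟨R, hR, hR1, -⟩ := hx.exists_mem_opGroup h0 h1
  obtain ⟨S, hS, -, hS1⟩ := hy.exists_mem_opGroup h0 h1
  have hxx := hx.form_self h0 h1
  have hyy := hy.form_self h0 h1
  obtain ⟨μ, hμ0, hμ⟩ := exists_add_inv_eq (Polynomial.aeval (-zeta α) G)
  have hroot := pow_ne_one_of_two_lt hn ht ht' G hr hG' hμ0 hμ.symm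
  set s := form α x y * form α y x with hs
  have hs1 : s ≠ 1 := by
    intro h
    refine hroot 1 one_pos ?_
    rw [hG, h] at hμ
    have h2 : (μ - 1) ^ 2 = 0 := by
      field_simp at hμ
      linear_combination hμ + μ * zeta_mul_rho α
    rw [pow_one]
    exact sub_eq_zero.1 (pow_eq_zero_iff two_ne_zero |>.1 h2)
  have hs0 : s ≠ 0 := by
    refine mul_ne_zero hxy ?_
    rw [← conj_form]
    exact (map_ne_zero _).2 hxy
  have hinv : (-zeta α)⁻¹ = -rho α := by rw [inv_neg, zeta_inv]
  have e1 : (1 : ℂ) - -zeta α = 1 + zeta α := by ring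
  have e2 : (1 : ℂ) - -rho α = 1 + rho α := by ring
  have hM : (R * S⁻¹).1 =
      (1 - (1 - -zeta α) • proj α x) * (1 - (1 - (-zeta α)⁻¹) • proj α y) := by
    rw [Units.val_mul, hR1, hS1, hinv, e1, e2]
  have hmem : R * S⁻¹ ∈ opGroup α d ⊓ SU α d := by
    rw [inf_SU_eq h0 h1]
    refine Subgroup.mem_inf.2 ⟨mul_mem hR (inv_mem hS), ?_⟩
    rw [mem_SL_iff, Units.val_mul, hR1, hS1, det_mul, det_one_sub_smul_proj,
      det_one_sub_smul_proj, hxx, hyy]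
    linear_combination zeta_mul_rho α
  have hPQ := proj_mul_proj_mul_proj (α := α) x y
  have hQP := proj_mul_proj_mul_proj (α := α) y x
  rw [mul_comm (form α y x)] at hQP
  have ht0 : -zeta α ≠ 0 := neg_ne_zero.2 (zeta_ne_zero α)
  refine exists_mem_tangent_of_pow_ne_one hmem hμ0 hroot ?_ fun a => ?_
  · have := sub_one_mul_eq_zero ht0 (proj_mul_self hxx) (proj_mul_self hyy) hPQ hQP hM
    rw [hinv, e1, e2] at this
    rw [hμ, hG, sub_eq_add_neg (-zeta α)]
    exact this
  · rw [hM]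
    refine mul_sub_smul_ne_smul_one ht0 (fun h => ?_) (proj_mul_self hxx) (proj_mul_self hyy) hPQ
      (fun h => ?_) hs0 hs1 a
    · exact one_add_zeta_ne_zero h0 h1 (by rw [← e1, h, sub_self])
    · have h2 := proj_mulVec (α := α) x x
      rw [h, zero_mulVec, hxx, one_smul] at h2
      rw [← h2] at hxx
      simp [form] at hxx

theorem neg_zeta_eq (α : ℝ) :
    -zeta α = Complex.exp (2 * Real.pi * Complex.I * ((1 / 2 - α : ℝ) : ℂ)) := by
  rw [zeta, rho, ← Complex.exp_neg, neg_eq_neg_one_mul, ← Complex.exp_pi_mul_I, ← Complex.exp_add]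
  congr 1
  push_cast
  ring

theorem exists_int_of_neg_zeta_pow_eq_one {n : ℕ} (h : (-zeta α) ^ n = 1) :
    ∃ m : ℤ, (n : ℝ) * (1 / 2 - α) = m := by
  rw [neg_zeta_eq, ← Complex.exp_nat_mul, Complex.exp_eq_one_iff] at h
  obtain ⟨m, hm⟩ := h
  refine ⟨m, ?_⟩
  have h2 : (2 * Real.pi * Complex.I : ℂ) ≠ 0 := by simp [Real.pi_ne_zero]
  have h3 : ((n * (1 / 2 - α) : ℝ) : ℂ) = ((m : ℝ) : ℂ) := by
    refine mul_right_cancel₀ h2 ?_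
    push_cast at hm ⊢
    linear_combination hm
  exact_mod_cast h3

theorem exp_add_inv (n : ℕ) : Complex.exp (2 * Real.pi * Complex.I / n) +
    (Complex.exp (2 * Real.pi * Complex.I / n))⁻¹ = (2 * Real.cos (2 * Real.pi / n) : ℝ) := by
  rw [← Complex.exp_neg]
  push_cast
  rw [Complex.two_cos]
  congr 2 <;> ring

theorem _root_.IsPrimitiveRoot.pow_sub_one_eq_inv {n : ℕ} (hn : 0 < n) {t : ℂ}
    (ht : IsPrimitiveRoot t n) : t ^ (n - 1) = t⁻¹ := by
  refine eq_inv_of_mul_eq_one_left ?_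
  rw [← pow_succ, Nat.sub_add_cancel hn, ht.pow_eq_one]

end Tangent

/-! ### Pairs of reflections with a product of infinite order -/

section Cases

variable {α : ℝ} {d : ℕ}

theorem one_add_zeta_mul_gram_of_lt (h0 : 0 < α) (h1 : α < 1 / 2) {p q : Fin d} (h : p < q) :
    gram α p q = zeta α * (1 + zeta α)⁻¹ := by
  rw [gram_of_lt h]
  have h2 := one_add_zeta_ne_zero h0 h1
  have h3 := one_add_rho_ne_zero h0 h1
  field_simp
  linear_combination -zeta_mul_rho α

/-- For the pair `e_0`, `e_1` the trace is `τ = 1 - ζ - ρ`, which has the conjugate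
`1 + 2 cos (2 π / n)`. -/
theorem exists_mem_tangent_of_seven_le (h0 : 0 < α) (h1 : α < 1 / 2) (hd : 2 ≤ d) {n : ℕ}
    (hn : 7 ≤ n) (ht : IsPrimitiveRoot (-zeta α) n) :
    ∃ Y ∈ tangent (opGroup α d ⊓ SU α d), ∀ a : ℂ, Y ≠ a • 1 := by
  have hn0 : 0 < n := by omega
  have ht' := Complex.isPrimitiveRoot_exp n hn0.ne'
  have hpq : (⟨0, by omega⟩ : Fin d) < ⟨1, by omega⟩ := by simp
  refine exists_mem_tangent_of_two_lt h0 h1 (x := e ⟨0, by omega⟩) (y := e ⟨1, by omega⟩)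
    (inOrbit_e _) (inOrbit_e _) hn0 ht ht' (1 + Polynomial.X + Polynomial.X ^ (n - 1))
    (r := 1 + 2 * Real.cos (2 * Real.pi / n)) ?_ ?_ ?_ ?_
  · have h2 : Real.cos (Real.pi / 3) < Real.cos (2 * Real.pi / n) := by
      refine Real.cos_lt_cos_of_nonneg_of_le_pi (by positivity) (by linarith [Real.pi_pos]) ?_
      have : (7 : ℝ) ≤ n := by exact_mod_cast hn
      rw [div_lt_div_iff₀ (by linarith) (by norm_num)]
      nlinarith [Real.pi_pos]
    rw [Real.cos_pi_div_three] at h2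
    linarith
  · simp only [map_add, map_one, map_pow, Polynomial.aeval_X, ht'.pow_sub_one_eq_inv hn0]
    rw [add_assoc, exp_add_inv]
    push_cast
    ring
  · rw [form_e_e]
    exact gram_ne_zero h0 h1 _ _
  · simp only [map_add, map_one, map_pow, Polynomial.aeval_X, ht.pow_sub_one_eq_inv hn0]
    rw [form_e_e, form_e_e, gram_of_gt hpq, gram_of_lt hpq, inv_neg, zeta_inv]
    have h2 := one_add_zeta_ne_zero h0 h1
    have h3 := one_add_rho_ne_zero h0 h1
    field_simp
    ring

/-- The orbit contains `y = L_1 e_0 = e_0 - ζ e_1`. For the pair `y`, `e_2` the trace is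
`τ = 2 - 2 ζ - 2 ρ`, which has the conjugate `2 + 4 cos (2 π / n)`. -/
theorem exists_mem_tangent_of_five_le (h0 : 0 < α) (h1 : α < 1 / 2) (hd : 3 ≤ d) {n : ℕ}
    (hn : 5 ≤ n) (ht : IsPrimitiveRoot (-zeta α) n) :
    ∃ Y ∈ tangent (opGroup α d ⊓ SU α d), ∀ a : ℂ, Y ≠ a • 1 := by
  have hn0 : 0 < n := by omega
  have ht' := Complex.isPrimitiveRoot_exp n hn0.ne'
  have h2 := one_add_zeta_ne_zero h0 h1
  set i0 : Fin d := ⟨0, by omega⟩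
  set i1 : Fin d := ⟨1, by omega⟩
  set i2 : Fin d := ⟨2, by omega⟩
  have h01 : i0 < i1 := by simp [i0, i1]
  have h02 : i0 < i2 := by simp [i0, i2]
  have h12 : i1 < i2 := by simp [i1, i2]
  have hy := (inOrbit_e (α := α) i0).sub_smul h0 h1 i1
  rw [form_e_e, one_add_zeta_mul_gram_of_lt h0 h1 h01, mul_left_comm, mul_inv_cancel₀ h2,
    mul_one] at hy
  have hf : form α (e i0 - zeta α • e i1) (e i2) = (1 - zeta α) * (1 + rho α)⁻¹ := by
    rw [form_sub_left, form_smul_left, form_e_e, form_e_e, gram_of_lt h02, gram_of_lt h12]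
    ring
  have hz1 : 1 - zeta α ≠ 0 := fun h => zeta_sq_ne_one h0 h1 (by
    rw [← sub_eq_zero.1 h, one_pow])
  have h3 := one_add_rho_ne_zero h0 h1
  refine exists_mem_tangent_of_two_lt h0 h1 hy (inOrbit_e i2) hn0 ht ht'
    (2 + 2 * Polynomial.X + 2 * Polynomial.X ^ (n - 1))
    (r := 2 + 2 * (2 * Real.cos (2 * Real.pi / n))) ?_ ?_ ?_ ?_
  · have h2 : 0 < Real.cos (2 * Real.pi / n) := by
      have h5 : (5 : ℝ) ≤ n := by exact_mod_cast hn
      refine Real.cos_pos_of_mem_Ioo ⟨?_, ?_⟩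
      · have : 0 ≤ 2 * Real.pi / n := by positivity
        linarith [Real.pi_pos]
      · rw [div_lt_div_iff₀ (by linarith) (by norm_num)]
        nlinarith [Real.pi_pos]
    linarith
  · simp only [map_add, map_mul, map_ofNat, map_pow, Polynomial.aeval_X,
      ht'.pow_sub_one_eq_inv hn0]
    rw [add_assoc, ← mul_add, exp_add_inv]
    push_cast
    ring
  · rw [hf]
    exact mul_ne_zero hz1 (inv_ne_zero h3)
  · simp only [map_add, map_mul, map_ofNat, map_pow, Polynomial.aeval_X,
      ht.pow_sub_one_eq_inv hn0]
    rw [← conj_form (e i0 - zeta α • e i1), hf, map_mul, map_inv₀, map_sub, map_add, map_one,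
      conj_zeta, conj_rho, inv_neg, zeta_inv]
    field_simp
    linear_combination -rho_mul_zeta α

/-- For `y = L_2 L_1 e_0` and `e_3` the trace is `τ = 4`. -/
theorem exists_mem_tangent_of_order_four (h0 : 0 < α) (h1 : α < 1 / 2) (hd : 4 ≤ d)
    (ht : IsPrimitiveRoot (-zeta α) 4) :
    ∃ Y ∈ tangent (opGroup α d ⊓ SU α d), ∀ a : ℂ, Y ≠ a • 1 := by
  have h2 := one_add_zeta_ne_zero h0 h1
  have hz2 : zeta α ^ 2 = -1 := by
    have h4 := ht.pow_eq_one
    have : (zeta α ^ 2 - 1) * (zeta α ^ 2 + 1) = 0 := by linear_combination h4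
    exact eq_neg_of_add_eq_zero_left
      ((mul_eq_zero.1 this).resolve_left (sub_ne_zero.2 (zeta_sq_ne_one h0 h1)))
  have hr : rho α = -zeta α := by
    rw [← zeta_inv]
    exact inv_eq_of_mul_eq_one_right (by linear_combination -hz2)
  set i0 : Fin d := ⟨0, by omega⟩
  set i1 : Fin d := ⟨1, by omega⟩
  set i2 : Fin d := ⟨2, by omega⟩
  set i3 : Fin d := ⟨3, by omega⟩
  have h01 : i0 < i1 := by simp [i0, i1]
  have h02 : i0 < i2 := by simp [i0, i2]
  have h12 : i1 < i2 := by simp [i1, i2]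
  have h03 : i0 < i3 := by simp [i0, i3]
  have h13 : i1 < i3 := by simp [i1, i3]
  have h23 : i2 < i3 := by simp [i2, i3]
  -- The vector `y`, computed step by step with `ζ ^ 2 = -1`.
  have hy1 := (inOrbit_e (α := α) i0).sub_smul h0 h1 i1
  have c1 : (1 + zeta α) * form α (e i0) (e i1) = zeta α := by
    rw [form_e_e, one_add_zeta_mul_gram_of_lt h0 h1 h01]
    field_simp
  rw [c1] at hy1
  have hy := hy1.sub_smul h0 h1 i2
  have c2 : (1 + zeta α) * form α (e i0 - zeta α • e i1) (e i2) = 1 + zeta α := by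
    simp only [form_sub_left, form_smul_left, form_e_e, one_add_zeta_mul_gram_of_lt h0 h1 h02,
      one_add_zeta_mul_gram_of_lt h0 h1 h12]
    field_simp
    linear_combination -hz2
  rw [c2] at hy
  set y := e i0 - _ - _ with hydef
  have hf : form α y (e i3) = (1 - zeta α) ^ 2 * (1 + rho α)⁻¹ := by
    rw [hydef]
    simp only [form_sub_left, form_smul_left, form_e_e, gram_of_lt h03, gram_of_lt h13,
      gram_of_lt h23]
    linear_combination (-(1 + rho α)⁻¹) * hz2
  have hz1 : 1 - zeta α ≠ 0 := fun h => zeta_sq_ne_one h0 h1 (by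
    rw [← sub_eq_zero.1 h, one_pow])
  have h3 := one_add_rho_ne_zero h0 h1
  refine exists_mem_tangent_of_two_lt h0 h1 hy (inOrbit_e i3) four_pos ht ht
    4 (r := 4) (by norm_num) (by rw [map_ofNat]; norm_num) ?_ ?_
  · rw [hf]
    exact mul_ne_zero (pow_ne_zero 2 hz1) (inv_ne_zero h3)
  · rw [← conj_form y, hf]
    simp only [map_mul, map_inv₀, map_sub, map_add, map_one, map_pow, map_ofNat,
      conj_zeta, conj_rho]
    field_simp
    rw [hr]
    linear_combination (-zeta α ^ 2 + 3) * hz2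

/-- For `y = L_1⁻¹ L_4 L_3 L_2 e_0` and `e_5` the trace is `τ = 3`. -/
theorem exists_mem_tangent_of_order_three (h0 : 0 < α) (h1 : α < 1 / 2) (hd : 6 ≤ d)
    (ht : IsPrimitiveRoot (-zeta α) 3) :
    ∃ Y ∈ tangent (opGroup α d ⊓ SU α d), ∀ a : ℂ, Y ≠ a • 1 := by
  have h2 := one_add_zeta_ne_zero h0 h1
  have h3 := one_add_rho_ne_zero h0 h1
  have hz2 : zeta α ^ 2 = zeta α - 1 := by
    have h4 := ht.pow_eq_one
    have : (1 + zeta α) * (zeta α ^ 2 - (zeta α - 1)) = 0 := by linear_combination -h4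
    exact sub_eq_zero.1 ((mul_eq_zero.1 this).resolve_left h2)
  have hr : rho α = 1 - zeta α := by
    rw [← zeta_inv]
    exact inv_eq_of_mul_eq_one_right (by linear_combination -hz2)
  set i0 : Fin d := ⟨0, by omega⟩
  set i1 : Fin d := ⟨1, by omega⟩
  set i2 : Fin d := ⟨2, by omega⟩
  set i3 : Fin d := ⟨3, by omega⟩
  set i4 : Fin d := ⟨4, by omega⟩
  set i5 : Fin d := ⟨5, by omega⟩
  have h01 : i0 < i1 := by simp [i0, i1]
  have h02 : i0 < i2 := by simp [i0, i2]
  have h03 : i0 < i3 := by simp [i0, i3]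
  have h04 : i0 < i4 := by simp [i0, i4]
  have h05 : i0 < i5 := by simp [i0, i5]
  have h12 : i1 < i2 := by simp [i1, i2]
  have h13 : i1 < i3 := by simp [i1, i3]
  have h14 : i1 < i4 := by simp [i1, i4]
  have h15 : i1 < i5 := by simp [i1, i5]
  have h23 : i2 < i3 := by simp [i2, i3]
  have h24 : i2 < i4 := by simp [i2, i4]
  have h25 : i2 < i5 := by simp [i2, i5]
  have h34 : i3 < i4 := by simp [i3, i4]
  have h35 : i3 < i5 := by simp [i3, i5]
  have h45 : i4 < i5 := by simp [i4, i5]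
  -- The vector `y`, computed step by step with `ρ = 1 - ζ`.
  have hy2 := (inOrbit_e (α := α) i0).sub_smul h0 h1 i2
  have c2 : (1 + zeta α) * form α (e i0) (e i2) = zeta α := by
    rw [form_e_e, one_add_zeta_mul_gram_of_lt h0 h1 h02]
    field_simp
  rw [c2] at hy2
  have hy3 := hy2.sub_smul h0 h1 i3
  have c3 : (1 + zeta α) * form α (e i0 - zeta α • e i2) (e i3) = 1 := by
    simp only [form_sub_left, form_smul_left, form_e_e, one_add_zeta_mul_gram_of_lt h0 h1 h03,
      one_add_zeta_mul_gram_of_lt h0 h1 h23]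
    field_simp
    linear_combination -hz2
  rw [c3] at hy3
  have hy4 := hy3.sub_smul h0 h1 i4
  have c4 : (1 + zeta α) * form α (e i0 - zeta α • e i2 - (1 : ℂ) • e i3) (e i4) =
      1 - zeta α := by
    simp only [form_sub_left, form_smul_left, form_e_e, one_add_zeta_mul_gram_of_lt h0 h1 h04,
      one_add_zeta_mul_gram_of_lt h0 h1 h24, one_add_zeta_mul_gram_of_lt h0 h1 h34]
    field_simp
    linear_combination -hz2
  rw [c4] at hy4
  have hy := hy4.sub_smul_inv h0 h1 i1
  have c1 : (1 + rho α) * form α (e i0 - zeta α • e i2 - (1 : ℂ) • e i3 - (1 - zeta α) • e i4)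
      (e i1) = 2 * zeta α - 1 := by
    simp only [form_sub_left, form_smul_left, form_e_e, gram_of_gt h12, gram_of_gt h13,
      gram_of_gt h14, one_add_zeta_mul_gram_of_lt h0 h1 h01, hr]
    field_simp
    linear_combination -3 * hz2
  rw [c1] at hy
  set y := e i0 - _ - _ - _ - _ with hydef
  have hf : form α y (e i5) = -2 * zeta α * (1 + rho α)⁻¹ := by
    rw [hydef]
    simp only [form_sub_left, form_smul_left, form_e_e, gram_of_lt h05, gram_of_lt h15,
      gram_of_lt h25, gram_of_lt h35, gram_of_lt h45]
    ring
  refine exists_mem_tangent_of_two_lt h0 h1 hy (inOrbit_e i5) three_pos ht ht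
    3 (r := 3) (by norm_num) (by rw [map_ofNat]; norm_num) ?_ ?_
  · rw [hf]
    exact mul_ne_zero (mul_ne_zero (by norm_num) (zeta_ne_zero α)) (inv_ne_zero h3)
  · rw [← conj_form y, hf]
    simp only [map_mul, map_inv₀, map_add, map_one, map_neg, map_ofNat, conj_zeta, conj_rho]
    field_simp
    rw [hr]
    linear_combination 4 * hz2

/-- If `-ζ` has finite order `n`, then `α = 1 / 2 - m / n` with `0 < 2 m < n`. The orders
`3`, `4`, `5` and `6` require a lower bound on the dimension. -/
theorem exists_mem_tangent (h0 : 0 < α) (h1 : α < 1 / 2) (hd : 2 ≤ d) (h6 : α = 1 / 6 → 6 ≤ d)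
    (h4 : α = 1 / 4 → 4 ≤ d) (h10 : α = 1 / 10 ∨ α = 3 / 10 ∨ α = 1 / 3 → 3 ≤ d) :
    ∃ Y ∈ tangent (opGroup α d ⊓ SU α d), ∀ a : ℂ, Y ≠ a • 1 := by
  by_cases ht : ∀ k : ℕ, 0 < k → (-zeta α) ^ k ≠ 1
  · exact exists_mem_tangent_of_infinite_order h0 h1 hd ht
  push Not at ht
  obtain ⟨k, hk, hk1⟩ := ht
  have hprim := IsPrimitiveRoot.orderOf (-zeta α)
  have hpos : 0 < orderOf (-zeta α) :=
    orderOf_pos_iff.2 (isOfFinOrder_iff_pow_eq_one.2 ⟨k, hk, hk1⟩)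
  set n := orderOf (-zeta α)
  obtain ⟨m, hm⟩ := exists_int_of_neg_zeta_pow_eq_one hprim.pow_eq_one
  have hm0 : 0 < m := by
    have h5 : (0 : ℝ) < m := by
      rw [← hm]
      exact mul_pos (by exact_mod_cast hpos) (by linarith)
    exact_mod_cast h5
  have hm1 : 2 * m < n := by
    have h5 : (2 * m : ℝ) < n := by
      rw [← hm]
      have : (0 : ℝ) < n := by exact_mod_cast hpos
      nlinarith
    exact_mod_cast h5
  by_cases hn7 : 7 ≤ n
  · exact exists_mem_tangent_of_seven_le h0 h1 hd hn7 hprim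
  by_cases hn5 : 5 ≤ n
  · refine exists_mem_tangent_of_five_le h0 h1 ?_ hn5 hprim
    have hn : n = 5 ∨ n = 6 := by omega
    have hm' : m = 1 ∨ m = 2 := by omega
    rcases hn with hn | hn <;> rcases hm' with hm' | hm' <;> rw [hn, hm'] at hm <;>
      push_cast at hm
    · exact h10 (Or.inr (Or.inl (by linarith)))
    · exact h10 (Or.inl (by linarith))
    · exact h10 (Or.inr (Or.inr (by linarith)))
    · exact le_trans (by norm_num) (h6 (by linarith))
  have hm' : m = 1 := by omega
  have hn : n = 3 ∨ n = 4 := by omega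
  rcases hn with hn | hn <;> rw [hn] at hm hprim <;> rw [hm'] at hm <;> push_cast at hm
  · exact exists_mem_tangent_of_order_three h0 h1 (h6 (by linarith)) hprim
  · exact exists_mem_tangent_of_order_four h0 h1 (h4 (by linarith)) hprim

end Cases

/-! ### Zariski density -/

section Density

variable {α : ℝ} {d : ℕ}

/-- The matrix whose rows are the linear forms `x ↦ Q_α (x, e_p)`. -/
noncomputable def dualMatrix (α : ℝ) (d : ℕ) : Matrix (Fin d) (Fin d) ℂ :=
  Matrix.of fun p q => gram α q p

theorem form_eq_dotProduct (x y : Fin d → ℂ) :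
    form α x y = star y ⬝ᵥ (dualMatrix α d *ᵥ x) := by
  rw [form, Finset.sum_comm]
  simp only [dotProduct, mulVec, Finset.mul_sum, dualMatrix, Matrix.of_apply, Pi.star_apply,
    RCLike.star_def]
  refine Finset.sum_congr rfl fun p _ => Finset.sum_congr rfl fun q _ => ?_
  ring

theorem isUnit_det_dualMatrix (hk : kernel α d = {0}) : IsUnit (dualMatrix α d).det := by
  rw [isUnit_iff_ne_zero, Ne, ← exists_mulVec_eq_zero_iff]
  rintro ⟨v, hv0, hv⟩
  have : v ∈ kernel α d := fun y => by
    rw [form_eq_dotProduct, hv, dotProduct_zero]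
  rw [hk] at this
  exact hv0 this

/-- When the form is nondegenerate and the tangent space contains a nonscalar matrix, the complex
Zariski closure of the group contains `SL`. -/
theorem mem_zclosure_of_exists_mem_tangent (h0 : 0 < α) (h1 : α < 1 / 2) (hd : 2 ≤ d)
    (hk : kernel α d = {0})
    (hY : ∃ Y ∈ tangent (opGroup α d ⊓ SU α d), ∀ a : ℂ, Y ≠ a • 1)
    (M : Matrix (Fin d) (Fin d) ℂ) (hM : M.det = 1) : M ∈ zclosure (opGroup α d ⊓ SU α d) := by
  obtain ⟨Y, hY, hYs⟩ := hY
  have : Nontrivial (Fin d) := Fin.nontrivial_iff_two_le.2 hd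
  refine mem_zclosure_of_det_eq_one (fun i j hij => ?_) M hM
  have hrow : ∀ p, dualMatrix α d p = dual α (e p) := fun p => by rw [dual_e]; rfl
  refine single_mem_of_conj_mem (Λ := dualMatrix α d) (L := fun p => (op α p).1)
    (L' := fun p => (op α p)⁻¹.1) (t := -zeta α) (neg_ne_zero.2 (zeta_ne_zero α))
    (by rw [neg_sq]; exact zeta_sq_ne_one h0 h1) (isUnit_det_dualMatrix hk)
    (fun p => gram_self p) (fun p q => gram_ne_zero h0 h1 q p)
    (fun p q r hpq hpr hqr => gram_ne_gram_mul_gram h0 h1 hpq hpr hqr) (fun p => ?_) (fun p => ?_)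
    (fun p Z hZ => conj_mem_tangent (conj_mem_inf_SU h0 h1 (op_mem_opGroup p)) hZ) hY hYs hij
  · rw [op_val h0 h1, sub_neg_eq_add, hrow]
    rfl
  · rw [op_inv_val h0 h1, inv_neg, zeta_inv, sub_neg_eq_add, hrow]
    rfl

/-- On the unitary group of a nondegenerate form, the conjugates of the entries are polynomials in
the entries, given by the adjugate matrix. -/
theorem map_conj_eq_of_mem_SU (hk : kernel α d = {0}) {g : GL (Fin d) ℂ} (hg : g ∈ SU α d) :
    g.1.map (starRingEnd ℂ) =
      ((dualMatrix α d)⁻¹)ᵀ * (adjugate g.1)ᵀ * (dualMatrix α d)ᵀ := by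
  set G := dualMatrix α d with hG
  have hGu : IsUnit G.det := isUnit_det_dualMatrix hk
  have hdet : g.1.det = 1 := (mem_SL_iff g).1 hg.2
  have h1 : g.1ᴴ * G * g.1 = G := by
    refine Matrix.ext_of_mulVec_single fun j => ?_
    ext i
    have h2 := hg.1 (Pi.single j 1) (Pi.single i 1)
    rw [form_eq_dotProduct, form_eq_dotProduct, star_mulVec, ← dotProduct_mulVec] at h2
    have h3 : star (Pi.single i (1 : ℂ) : Fin d → ℂ) = Pi.single i 1 := by
      ext k; by_cases h : k = i <;> simp [h]
    rw [h3, single_one_dotProduct, single_one_dotProduct] at h2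
    simpa only [← mulVec_mulVec] using h2
  have h2 : g.1 * adjugate g.1 = 1 := by rw [mul_adjugate, hdet, one_smul]
  have h3 : g.1ᴴ = G * adjugate g.1 * G⁻¹ := by
    have h4 : g.1ᴴ * G * g.1 * adjugate g.1 * G⁻¹ = G * adjugate g.1 * G⁻¹ := by rw [h1]
    rw [mul_assoc _ g.1, h2, mul_one, mul_assoc, mul_nonsing_inv _ hGu, mul_one] at h4
    exact h4
  have h5 : g.1.map (starRingEnd ℂ) = (g.1ᴴ)ᵀ := by
    ext i j; simp
  rw [h5, h3, transpose_mul, transpose_mul, mul_assoc]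

/-- Since the entries of `conj g` are polynomials in the entries of `g` on the unitary group, real
Zariski density follows from density for the complex Zariski topology. -/
theorem zariskiDenseIn_of_forall_mem_zclosure (hk : kernel α d = {0})
    (h : ∀ g ∈ SU α d, g.1 ∈ zclosure (opGroup α d ⊓ SU α d)) :
    ZariskiDenseIn (opGroup α d ⊓ SU α d) (SU α d) := by
  refine ⟨inf_le_right, fun g hg P hP => ?_⟩
  let Cj : Matrix (Fin d) (Fin d) (MvPolynomial (Fin d × Fin d) ℂ) :=
    ((dualMatrix α d)⁻¹)ᵀ.map MvPolynomial.C * (adjugate (mvPolynomialX (Fin d) (Fin d) ℂ))ᵀ *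
      (dualMatrix α d)ᵀ.map MvPolynomial.C
  let φ : MvPolynomial ((Fin d × Fin d) ⊕ (Fin d × Fin d)) ℝ →ₐ[ℝ]
      MvPolynomial (Fin d × Fin d) ℂ :=
    MvPolynomial.aeval (Sum.elim
      (fun ij => MvPolynomial.C (1 / 2) * (MvPolynomial.X ij + Cj ij.1 ij.2))
      (fun ij => MvPolynomial.C (1 / (2 * Complex.I)) * (MvPolynomial.X ij - Cj ij.1 ij.2)))
  have hC : ∀ u ∈ SU α d, ∀ i j, evalMat u.1 (Cj i j) = (starRingEnd ℂ) (u.1 i j) := by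
    intro u hu i j
    have h2 := congrFun (congrFun (map_conj_eq_of_mem_SU hk hu) i) j
    rw [Matrix.map_apply] at h2
    rw [h2, evalMat_apply_mul, Matrix.map_mul, evalMat_map_C, evalMat_map_C]
    have h3 := AlgHom.map_adjugate (evalMat u.1) (mvPolynomialX (Fin d) (Fin d) ℂ)
    have h4 := evalMat_mvPolynomialX u.1
    rw [AlgHom.mapMatrix_apply, AlgHom.mapMatrix_apply, h4] at h3
    rw [← h3]
    rfl
  have hφ : ∀ u ∈ SU α d, ∀ P, evalMat u.1 (φ P) = (MvPolynomial.eval (realCoord u.1) P : ℝ) := by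
    intro u hu P
    have h2 : ((evalMat u.1).restrictScalars ℝ).comp φ =
        (Complex.ofRealAm).comp (MvPolynomial.aeval (realCoord u.1)) := by
      refine MvPolynomial.algHom_ext fun ij => ?_
      rcases ij with ij | ij
      · simp only [φ, AlgHom.comp_apply, MvPolynomial.aeval_X, Sum.elim_inl,
          AlgHom.restrictScalars_apply, map_mul, map_add, evalMat_C, evalMat_X, hC u hu,
          realCoord, Complex.ofRealAm_coe]
        rw [Complex.re_eq_add_conj]
        ring
      · simp only [φ, AlgHom.comp_apply, MvPolynomial.aeval_X, Sum.elim_inr,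
          AlgHom.restrictScalars_apply, map_mul, map_sub, evalMat_C, evalMat_X, hC u hu,
          realCoord, Complex.ofRealAm_coe]
        rw [Complex.im_eq_sub_conj]
        ring
    have h3 := DFunLike.congr_fun h2 P
    simpa [MvPolynomial.aeval_eq_eval] using h3
  have h2 : VanishesOn (opGroup α d ⊓ SU α d) (φ P) := fun u hu => by
    rw [hφ u hu.2, hP u hu, Complex.ofReal_zero]
  have h3 := h g hg (φ P) h2
  rw [hφ g hg] at h3
  exact_mod_cast h3

theorem zariskiDenseIn_SU (h0 : 0 < α) (h1 : α < 1 / 2) (hd : 2 ≤ d) (hk : kernel α d = {0})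
    (h6 : α = 1 / 6 → 6 ≤ d) (h4 : α = 1 / 4 → 4 ≤ d)
    (h10 : α = 1 / 10 ∨ α = 3 / 10 ∨ α = 1 / 3 → 3 ≤ d) :
    ZariskiDenseIn (opGroup α d ⊓ SU α d) (SU α d) :=
  zariskiDenseIn_of_forall_mem_zclosure hk fun g hg =>
    mem_zclosure_of_exists_mem_tangent h0 h1 hd hk (exists_mem_tangent h0 h1 hd h6 h4 h10) g.1
      ((mem_SL_iff g).1 hg.2)

end Density

/-! ### The spectrum of the Gram matrix -/

section Signature

variable {α : ℝ} {d : ℕ}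

/-- Half of the argument of the number `eigRoot α d j`. -/
noncomputable def eigAngle (α : ℝ) (d : ℕ) (j : Fin d) : ℝ := Real.pi * (α + j) / d

/-- The `d`-th roots of `ρ`. -/
noncomputable def eigRoot (α : ℝ) (d : ℕ) (j : Fin d) : ℂ :=
  Complex.exp ((2 * eigAngle α d j : ℝ) * Complex.I)

/-- The eigenvectors of the Gram matrix of `Q_α`, a circulant matrix up to the twist by `ρ`. -/
noncomputable def eigVec (α : ℝ) (d : ℕ) (j : Fin d) : Fin d → ℂ :=
  fun p => (starRingEnd ℂ) (eigRoot α d j) ^ (p : ℕ)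

/-- The eigenvalues of the Gram matrix of `Q_α`. -/
noncomputable def eigVal (α : ℝ) (d : ℕ) (j : Fin d) : ℝ :=
  Real.sin (eigAngle α d j + Real.pi * α) /
    (2 * Real.cos (Real.pi * α) * Real.sin (eigAngle α d j))

theorem eigRoot_eq (hd : 0 < d) (j : Fin d) : eigRoot α d j =
    Complex.exp (2 * Real.pi * Complex.I * α / d) *
      Complex.exp (2 * Real.pi * Complex.I / d) ^ (j : ℕ) := by
  have : (d : ℂ) ≠ 0 := by exact_mod_cast hd.ne'
  rw [eigRoot, ← Complex.exp_nat_mul, ← Complex.exp_add, eigAngle]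
  congr 1
  push_cast
  field_simp

theorem eigRoot_injective : Function.Injective (eigRoot α d) := by
  intro i j h
  have hd : 0 < d := i.pos
  rw [eigRoot_eq hd, eigRoot_eq hd] at h
  exact Fin.ext ((Complex.isPrimitiveRoot_exp d hd.ne').pow_inj i.2 j.2
    (mul_left_cancel₀ (Complex.exp_ne_zero _) h))

theorem eigRoot_pow (j : Fin d) : eigRoot α d j ^ d = rho α := by
  have hd : 0 < d := j.pos
  rw [eigRoot_eq hd, mul_pow, ← pow_mul, mul_comm (j : ℕ), pow_mul,
    (Complex.isPrimitiveRoot_exp d hd.ne').pow_eq_one, one_pow, mul_one, ← Complex.exp_nat_mul, rho]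
  congr 1
  have : (d : ℂ) ≠ 0 := by exact_mod_cast hd.ne'
  field_simp

theorem conj_eigRoot_mul (j : Fin d) : (starRingEnd ℂ) (eigRoot α d j) * eigRoot α d j = 1 := by
  rw [eigRoot, ← Complex.exp_conj, ← Complex.exp_add, map_mul, Complex.conj_I,
    Complex.conj_ofReal, mul_neg, neg_add_cancel, Complex.exp_zero]

theorem sin_eigAngle_pos (h0 : 0 < α) (h1 : α < 1 / 2) (j : Fin d) :
    0 < Real.sin (eigAngle α d j) := by
  have hd : (0 : ℝ) < d := by exact_mod_cast j.pos
  have hj : ((j : ℕ) : ℝ) + 1 ≤ d := by exact_mod_cast j.2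
  refine Real.sin_pos_of_pos_of_lt_pi ?_ ?_
  · rw [eigAngle]
    have : (0 : ℝ) ≤ (j : ℕ) := Nat.cast_nonneg _
    exact div_pos (mul_pos Real.pi_pos (by linarith)) hd
  · rw [eigAngle, div_lt_iff₀ hd]
    exact mul_lt_mul_of_pos_left (by linarith) Real.pi_pos

theorem cos_pi_mul_pos (h0 : 0 < α) (h1 : α < 1 / 2) : 0 < Real.cos (Real.pi * α) := by
  refine Real.cos_pos_of_mem_Ioo ⟨?_, ?_⟩ <;> nlinarith [Real.pi_pos]

theorem exp_two_mul_sub_one (x : ℝ) : Complex.exp ((2 * x : ℝ) * Complex.I) - 1 =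
    2 * Complex.I * Complex.exp (x * Complex.I) * Real.sin x := by
  have h1 : Complex.exp ((2 * x : ℝ) * Complex.I) =
      Complex.exp (x * Complex.I) * Complex.exp (x * Complex.I) := by
    rw [← Complex.exp_add]; congr 1; push_cast; ring
  have h2 : Complex.exp (x * Complex.I) * Complex.exp (-x * Complex.I) = 1 := by
    rw [← Complex.exp_add, neg_mul, add_neg_cancel, Complex.exp_zero]
  have h3 : 2 * Complex.I * (Real.sin x : ℂ) =
      Complex.exp (x * Complex.I) - Complex.exp (-x * Complex.I) := by
    rw [Complex.ofReal_sin, mul_right_comm, Complex.two_sin]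
    linear_combination (Complex.exp (-x * Complex.I) - Complex.exp (x * Complex.I)) *
      Complex.I_mul_I
  rw [h1]
  linear_combination h2 - Complex.exp (x * Complex.I) * h3

theorem eigRoot_ne_one (h0 : 0 < α) (h1 : α < 1 / 2) (j : Fin d) : eigRoot α d j ≠ 1 := by
  rw [← sub_ne_zero, eigRoot, exp_two_mul_sub_one]
  exact mul_ne_zero
    (mul_ne_zero (mul_ne_zero two_ne_zero Complex.I_ne_zero) (Complex.exp_ne_zero _))
    (Complex.ofReal_ne_zero.2 (sin_eigAngle_pos h0 h1 j).ne')

/-- In terms of `l = eigRoot α d j`, the eigenvalue is `(ρ l - 1) / ((1 + ρ) (l - 1))`. -/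
theorem eigVal_mul (h0 : 0 < α) (h1 : α < 1 / 2) (j : Fin d) :
    (eigVal α d j : ℂ) * ((1 + rho α) * (eigRoot α d j - 1)) = rho α * eigRoot α d j - 1 := by
  have hs : (Real.sin (eigAngle α d j) : ℂ) ≠ 0 :=
    Complex.ofReal_ne_zero.2 (sin_eigAngle_pos h0 h1 j).ne'
  have hc : (Real.cos (Real.pi * α) : ℂ) ≠ 0 :=
    Complex.ofReal_ne_zero.2 (cos_pi_mul_pos h0 h1).ne'
  have e1 : rho α * eigRoot α d j - 1 = 2 * Complex.I *
      Complex.exp ((eigAngle α d j + Real.pi * α : ℝ) * Complex.I) *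
        Real.sin (eigAngle α d j + Real.pi * α) := by
    rw [← exp_two_mul_sub_one, rho_eq, eigRoot, ← Complex.exp_add]
    congr 2
    push_cast
    ring
  have e2 : 1 + rho α =
      2 * Complex.exp ((Real.pi * α : ℝ) * Complex.I) * Real.cos (Real.pi * α) := by
    rw [mul_right_comm, Complex.ofReal_cos, Complex.two_cos, add_mul, ← Complex.exp_add,
      ← Complex.exp_add, neg_mul, neg_add_cancel, Complex.exp_zero, rho_eq, add_comm]
    congr 2
    push_cast
    ring
  have e3 : Complex.exp ((eigAngle α d j + Real.pi * α : ℝ) * Complex.I) =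
      Complex.exp (eigAngle α d j * Complex.I) * Complex.exp ((Real.pi * α : ℝ) * Complex.I) := by
    rw [← Complex.exp_add]
    congr 1
    push_cast
    ring
  rw [e1, e2, e3, eigRoot, exp_two_mul_sub_one, eigVal]
  push_cast at hs hc ⊢
  field_simp

/-- The eigenvalue equation: a sum of two geometric progressions, evaluated with `l ^ d = ρ`. -/
theorem sum_pow_mul_gram (h0 : 0 < α) (h1 : α < 1 / 2) (j p : Fin d) :
    ∑ q : Fin d, eigRoot α d j ^ (q : ℕ) * gram α p q =
      eigVal α d j * eigRoot α d j ^ (p : ℕ) := by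
  set l := eigRoot α d j with hl
  have hl1 : l ≠ 1 := eigRoot_ne_one h0 h1 j
  have hρ := one_add_rho_ne_zero h0 h1
  let f : ℕ → ℂ := fun q => l ^ q *
    (if p = q then 1 else if q < p then 1 - (1 + rho α)⁻¹ else (1 + rho α)⁻¹)
  have h2 : ∀ q : Fin d, l ^ (q : ℕ) * gram α p q = f q := by
    intro q
    simp only [f]
    rcases lt_trichotomy p q with h | h | h
    · rw [gram_of_lt h, if_neg (by simpa [Fin.ext_iff] using h.ne),
        if_neg (by simpa using h.le)]
    · rw [h, gram_self, if_pos rfl]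
    · rw [gram_of_gt h, if_neg (by simpa [Fin.ext_iff] using h.ne'), if_pos (by simpa using h),
        inv_one_add_rho h0 h1]
      ring
  have hp : (p : ℕ) < d := p.2
  rw [Finset.sum_congr rfl fun q _ => h2 q, Fin.sum_univ_eq_sum_range f d, Finset.range_eq_Ico,
    ← Finset.sum_Ico_consecutive f (Nat.zero_le p) hp.le, Finset.sum_eq_sum_Ico_succ_bot hp]
  have e1 : ∑ q ∈ Finset.Ico 0 (p : ℕ), f q =
      (1 - (1 + rho α)⁻¹) * ((l ^ (p : ℕ) - l ^ 0) / (l - 1)) := by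
    rw [← geom_sum_Ico hl1 (Nat.zero_le _), Finset.mul_sum]
    refine Finset.sum_congr rfl fun q hq => ?_
    have hq := (Finset.mem_Ico.1 hq).2
    simp only [f]
    rw [if_neg hq.ne', if_pos hq, mul_comm]
  have e2 : ∑ q ∈ Finset.Ico ((p : ℕ) + 1) d, f q =
      (1 + rho α)⁻¹ * ((l ^ d - l ^ ((p : ℕ) + 1)) / (l - 1)) := by
    rw [← geom_sum_Ico hl1 hp, Finset.mul_sum]
    refine Finset.sum_congr rfl fun q hq => ?_
    have hq := (Finset.mem_Ico.1 hq).1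
    simp only [f]
    rw [if_neg (by omega), if_neg (by omega), mul_comm]
  have e3 : f p = l ^ (p : ℕ) := by simp [f]
  have e4 := eigVal_mul h0 h1 j
  rw [← hl] at e4
  have hl2 := sub_ne_zero.2 hl1
  rw [e1, e2, e3, eigRoot_pow]
  have e5 : (eigVal α d j : ℂ) = (rho α * l - 1) / ((1 + rho α) * (l - 1)) := by
    rw [eq_div_iff (mul_ne_zero hρ hl2), e4]
  rw [e5]
  field_simp
  ring

theorem form_eigVec (h0 : 0 < α) (h1 : α < 1 / 2) (i j : Fin d) :
    form α (eigVec α d i) (eigVec α d j) = if i = j then ((d * eigVal α d i : ℝ) : ℂ) else 0 := by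
  have h2 : form α (eigVec α d i) (eigVec α d j) = eigVal α d j *
      ∑ p : Fin d, ((starRingEnd ℂ) (eigRoot α d i) * eigRoot α d j) ^ (p : ℕ) := by
    rw [form_eq_sum_dual, Finset.mul_sum]
    refine Finset.sum_congr rfl fun p _ => ?_
    simp only [eigVec, map_pow, Complex.conj_conj]
    rw [sum_pow_mul_gram h0 h1]
    ring
  rw [h2]
  split_ifs with hij
  · rw [hij, conj_eigRoot_mul]
    simp
    ring
  · set l := (starRingEnd ℂ) (eigRoot α d i) * eigRoot α d j with hl
    have hl1 : l ≠ 1 := by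
      intro h
      refine hij (eigRoot_injective (α := α) ?_)
      have h3 := conj_eigRoot_mul (α := α) i
      rw [← h] at h3
      exact mul_left_cancel₀ (left_ne_zero_of_mul_eq_one (conj_eigRoot_mul i)) h3
    have hld : l ^ d = 1 := by
      rw [hl, mul_pow, ← map_pow, eigRoot_pow, eigRoot_pow, conj_rho, zeta_mul_rho]
    have h3 := geom_sum_eq hl1 d
    rw [hld, sub_self, zero_div, ← Fin.sum_univ_eq_sum_range (fun q => l ^ q)] at h3
    rw [h3, mul_zero]

/-- The eigenvectors of the Gram matrix form a basis, by the Vandermonde determinant. -/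
noncomputable def eigBasis (α : ℝ) (d : ℕ) : Module.Basis (Fin d) ℂ (Fin d → ℂ) :=
  have hli : LinearIndependent ℂ (eigVec α d) := by
    have h : (vandermonde fun j => (starRingEnd ℂ) (eigRoot α d j)).det ≠ 0 :=
      det_vandermonde_ne_zero_iff.2 ((starRingEnd ℂ).injective.comp eigRoot_injective)
    exact linearIndependent_rows_of_det_ne_zero h
  .mk hli (hli.span_eq_top_of_card_eq_finrank' (by simp)).ge

theorem eigBasis_apply (j : Fin d) : eigBasis α d j = eigVec α d j := by
  simp [eigBasis]

theorem eigAngle_add_eq (j : Fin d) :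
    eigAngle α d j + Real.pi * α = Real.pi * ((α + j) / d + α) := by
  rw [eigAngle]; ring

theorem add_div_add_lt_one_iff (j : Fin d) :
    (α + j) / d + α < 1 ↔ ((j : ℕ) : ℝ) < ((d : ℝ) + 1) * (1 - α) - 1 := by
  have hd : (0 : ℝ) < d := by exact_mod_cast j.pos
  rw [← lt_sub_iff_add_lt, div_lt_iff₀ hd]
  constructor <;> intro h <;> linarith

theorem one_lt_add_div_add_iff (j : Fin d) :
    1 < (α + j) / d + α ↔ ((d : ℝ) + 1) * (1 - α) - 1 < ((j : ℕ) : ℝ) := by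
  have hd : (0 : ℝ) < d := by exact_mod_cast j.pos
  rw [← sub_lt_iff_lt_add, lt_div_iff₀ hd]
  constructor <;> intro h <;> linarith

theorem eigVal_pos (h0 : 0 < α) (h1 : α < 1 / 2) {j : Fin d}
    (h : ((j : ℕ) : ℝ) < ((d : ℝ) + 1) * (1 - α) - 1) : 0 < eigVal α d j := by
  have hd : (0 : ℝ) < d := by exact_mod_cast j.pos
  rw [eigVal, eigAngle_add_eq]
  refine div_pos (Real.sin_pos_of_pos_of_lt_pi ?_ ?_)
    (mul_pos (mul_pos two_pos (cos_pi_mul_pos h0 h1)) (sin_eigAngle_pos h0 h1 j))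
  · have : (0 : ℝ) ≤ (j : ℕ) := Nat.cast_nonneg _
    positivity
  · have := mul_lt_mul_of_pos_left ((add_div_add_lt_one_iff j).2 h) Real.pi_pos
    linarith

theorem eigVal_neg (h0 : 0 < α) (h1 : α < 1 / 2) {j : Fin d}
    (h : ((d : ℝ) + 1) * (1 - α) - 1 < ((j : ℕ) : ℝ)) : eigVal α d j < 0 := by
  have hd : (0 : ℝ) < d := by exact_mod_cast j.pos
  have hj : ((j : ℕ) : ℝ) + 1 ≤ d := by exact_mod_cast j.2
  rw [eigVal, eigAngle_add_eq]
  refine div_neg_of_neg_of_pos ?_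
    (mul_pos (mul_pos two_pos (cos_pi_mul_pos h0 h1)) (sin_eigAngle_pos h0 h1 j))
  have h2 : (α + j) / d ≤ 1 := by
    rw [div_le_one hd]; linarith
  rw [← neg_pos, ← Real.sin_sub_pi]
  refine Real.sin_pos_of_pos_of_lt_pi ?_ ?_
  · have := mul_lt_mul_of_pos_left ((one_lt_add_div_add_iff j).2 h) Real.pi_pos
    linarith
  · nlinarith [Real.pi_pos]

theorem eigVal_eq_zero {j : Fin d} (h : ((j : ℕ) : ℝ) = ((d : ℝ) + 1) * (1 - α) - 1) :
    eigVal α d j = 0 := by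
  have hd : (0 : ℝ) < d := by exact_mod_cast j.pos
  have h2 : (α + j) / d + α = 1 := by
    rw [h]; field_simp; ring
  rw [eigVal, eigAngle_add_eq, h2, mul_one, Real.sin_pi, zero_div]

theorem natCard_lt {d : ℕ} {a : ℤ} (h0 : 0 ≤ a) (h1 : a ≤ d) :
    (Nat.card {j : Fin d // ((j : ℕ) : ℤ) < a} : ℤ) = a := by
  lift a to ℕ using h0
  have h1 : a ≤ d := by exact_mod_cast h1
  have h2 : Nat.card {j : Fin d // ((j : ℕ) : ℤ) < (a : ℤ)} = Nat.card (Fin a) :=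
    Nat.card_congr
      { toFun := fun j => ⟨j.1, by exact_mod_cast j.2⟩
        invFun := fun k => ⟨⟨k, k.2.trans_le h1⟩, by exact_mod_cast k.2⟩
        left_inv := fun j => rfl
        right_inv := fun k => rfl }
  rw [h2, Nat.card_fin]

theorem natCard_not_lt {d : ℕ} {a : ℤ} (h0 : 0 ≤ a) (h1 : a ≤ d) :
    (Nat.card {j : Fin d // ¬ ((j : ℕ) : ℤ) < a} : ℤ) = d - a := by
  have h2 := natCard_lt h0 h1
  rw [Nat.card_eq_fintype_card] at h2 ⊢
  rw [Fintype.card_subtype_compl, Fintype.card_fin, Nat.cast_sub, h2]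
  simpa using Fintype.card_subtype_le fun j : Fin d => ((j : ℕ) : ℤ) < a

theorem hasSignature (h0 : 0 < α) (h1 : α < 1 / 2) (hd : 2 ≤ d) :
    HasSignature α d ⌈((d : ℝ) + 1) * (1 - α) - 1⌉ ⌈((d : ℝ) + 1) * α - 1⌉ := by
  set B := ((d : ℝ) + 1) * (1 - α) - 1 with hB
  have hd2 : (2 : ℝ) ≤ d := by exact_mod_cast hd
  have hd0 : (0 : ℝ) < d := by linarith
  have hform : ∀ i, (form α (eigBasis α d i) (eigBasis α d i)).re = d * eigVal α d i := by
    intro i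
    rw [eigBasis_apply, form_eigVec h0 h1, if_pos rfl, Complex.ofReal_re]
  have hpos : ∀ i : Fin d, 0 < d * eigVal α d i ↔ ((i : ℕ) : ℝ) < B := by
    intro i
    refine ⟨fun h => ?_, fun h => mul_pos hd0 (eigVal_pos h0 h1 h)⟩
    by_contra! h2
    rcases h2.lt_or_eq with h3 | h3
    · exact (mul_neg_of_pos_of_neg hd0 (eigVal_neg h0 h1 h3)).not_gt h
    · rw [eigVal_eq_zero h3.symm, mul_zero] at h
      exact h.false
  have hneg : ∀ i : Fin d, d * eigVal α d i < 0 ↔ B < ((i : ℕ) : ℝ) := by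
    intro i
    refine ⟨fun h => ?_, fun h => mul_neg_of_pos_of_neg hd0 (eigVal_neg h0 h1 h)⟩
    by_contra! h2
    rcases h2.lt_or_eq with h3 | h3
    · exact (mul_pos hd0 (eigVal_pos h0 h1 h3)).not_gt h
    · rw [eigVal_eq_zero h3, mul_zero] at h
      exact h.false
  have hB0 : 0 < B := by nlinarith
  have hBd : B < d := by nlinarith
  refine ⟨eigBasis α d, fun i j hij => ?_, ?_, ?_⟩
  · rw [eigBasis_apply, eigBasis_apply, form_eigVec h0 h1, if_neg hij]
  · rw [← natCard_lt (d := d) (a := ⌈B⌉) (Int.ceil_nonneg hB0.le)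
      (Int.ceil_le.2 (by exact_mod_cast hBd.le))]
    congr 1
    refine Nat.card_congr (Equiv.subtypeEquivRight fun i => ?_)
    rw [hform, hpos, Int.lt_ceil, Int.cast_natCast]
  · have h2 : ⌈((d : ℝ) + 1) * α - 1⌉ = d - (⌊B⌋ + 1) := by
      have : ((d : ℝ) + 1) * α - 1 = ((d - 1 : ℤ) : ℝ) - B := by
        rw [hB]; push_cast; ring
      rw [this, sub_eq_add_neg, Int.ceil_intCast_add, Int.ceil_neg]
      ring
    have hfl : ⌊B⌋ < d := Int.floor_lt.2 (by exact_mod_cast hBd)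
    rw [h2, ← natCard_not_lt (d := d) (a := ⌊B⌋ + 1) (by have := Int.floor_nonneg.2 hB0.le; omega)
      (by omega)]
    congr 1
    refine Nat.card_congr (Equiv.subtypeEquivRight fun i => ?_)
    rw [hform, hneg, Int.lt_add_one_iff, not_le, Int.floor_lt, Int.cast_natCast]

theorem kernel_eq_of_not_int (h0 : 0 < α) (h1 : α < 1 / 2)
    (h : ¬ ∃ m : ℤ, ((d : ℝ) + 1) * α = m) : kernel α d = {0} := by
  refine Set.Subset.antisymm (fun x hx => ?_) ?_
  · have hval : ∀ j : Fin d, eigVal α d j ≠ 0 := by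
      intro j
      rcases lt_trichotomy ((j : ℕ) : ℝ) (((d : ℝ) + 1) * (1 - α) - 1) with h2 | h2 | h2
      · exact (eigVal_pos h0 h1 h2).ne'
      · exact absurd ⟨d - j, by push_cast; rw [h2]; ring⟩ h
      · exact (eigVal_neg h0 h1 h2).ne
    have hrepr : (eigBasis α d).repr x = 0 := by
      ext j
      have h2 := hx (eigBasis α d j)
      rw [← (eigBasis α d).sum_repr x, form_sum_left, Finset.sum_eq_single j] at h2
      · rw [form_smul_left, eigBasis_apply, form_eigVec h0 h1, if_pos rfl] at h2
        refine (mul_eq_zero.1 h2).resolve_right (Complex.ofReal_ne_zero.2 (mul_ne_zero ?_ (hval j)))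
        exact_mod_cast j.pos.ne'
      · intro i _ hij
        rw [form_smul_left, eigBasis_apply, eigBasis_apply, form_eigVec h0 h1, if_neg hij, mul_zero]
      · exact fun hj => absurd (Finset.mem_univ j) hj
    exact (eigBasis α d).repr.map_eq_zero_iff.1 hrepr
  · rintro _ rfl y
    simp [form]

/-- If `(d + 1) α` is an integer, the form is degenerate. -/
theorem exists_ne_zero_forall_form_eq_zero (h0 : 0 < α) (h1 : α < 1 / 2) (hd : 1 ≤ d) {m : ℤ}
    (h : ((d : ℝ) + 1) * α = m) : ∃ x : Fin d → ℂ, x ≠ 0 ∧ ∀ y, form α x y = 0 := by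
  have hd1 : (1 : ℝ) ≤ d := by exact_mod_cast hd
  have hm0 : 0 < m := by
    have : (0 : ℝ) < m := by rw [← h]; positivity
    exact_mod_cast this
  have hm1 : m ≤ d := by
    have : (m : ℝ) ≤ d := by rw [← h]; nlinarith
    exact_mod_cast this
  let j : Fin d := ⟨(d - m).toNat, by omega⟩
  have hj : ((j : ℕ) : ℝ) = ((d : ℝ) + 1) * (1 - α) - 1 := by
    have h2 : ((j : ℕ) : ℤ) = d - m := Int.toNat_of_nonneg (by omega)
    have h3 : ((j : ℕ) : ℝ) = d - m := by exact_mod_cast congrArg (Int.cast : ℤ → ℝ) h2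
    rw [h3, ← h]
    ring
  refine ⟨eigBasis α d j, (eigBasis α d).ne_zero j, fun y => ?_⟩
  rw [← conj_form, ← (eigBasis α d).sum_repr y, form_sum_left, map_sum]
  refine Finset.sum_eq_zero fun i _ => ?_
  rw [form_smul_left, eigBasis_apply, eigBasis_apply, form_eigVec h0 h1]
  split_ifs with hij
  · rw [hij, eigVal_eq_zero hj]
    simp
  · simp

theorem gram_succAbove (p : Fin (d + 1)) (i j : Fin d) :
    gram α (p.succAbove i) (p.succAbove j) = gram α i j := by
  simp [gram]

/-- The restriction of `Q_α` to a coordinate hyperplane is the form in one dimension less. -/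
theorem form_insertNth (p : Fin (d + 1)) (x : Fin d → ℂ) {y : Fin (d + 1) → ℂ} (hy : y p = 0) :
    form α (p.insertNth (α := fun _ => ℂ) 0 x) y = form α x (p.removeNth y) := by
  simp [form, Fin.sum_univ_succAbove _ p, hy, gram_succAbove, Fin.removeNth]

end Signature

/-! ### Density in compact groups -/

section Compact

open MeasureTheory

variable {d : ℕ}

theorem continuous_realCoord : Continuous fun g : GL (Fin d) ℂ => realCoord g.1 := by
  refine continuous_pi fun ij => ?_
  have h : ∀ i j, Continuous fun g : GL (Fin d) ℂ => g.1 i j := fun i j =>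
    Units.continuous_val.matrix_elem i j
  rcases ij with ij | ij
  · exact Complex.continuous_re.comp (h ij.1 ij.2)
  · exact Complex.continuous_im.comp (h ij.1 ij.2)

theorem continuous_eval_realCoord (P : MvPolynomial ((Fin d × Fin d) ⊕ (Fin d × Fin d)) ℝ) :
    Continuous fun g : GL (Fin d) ℂ => MvPolynomial.eval (realCoord g.1) P :=
  (MvPolynomial.continuous_eval P).comp continuous_realCoord

theorem realCoord_injective : Function.Injective fun g : GL (Fin d) ℂ => realCoord g.1 := by
  intro g h hgh
  refine Units.ext (Matrix.ext fun i j => Complex.ext ?_ ?_)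
  · exact congrFun hgh (Sum.inl (i, j))
  · exact congrFun hgh (Sum.inr (i, j))

/-- The average of the right translates of a polynomial over a compact group is a polynomial. -/
theorem exists_eval_eq_integral {K : Subgroup (GL (Fin d) ℂ)} [CompactSpace K]
    [MeasurableSpace K] [BorelSpace K] (μ : Measure K) [IsFiniteMeasure μ]
    (P : MvPolynomial ((Fin d × Fin d) ⊕ (Fin d × Fin d)) ℝ) :
    ∀ c : K → ℝ, Continuous c → ∃ Q : MvPolynomial ((Fin d × Fin d) ⊕ (Fin d × Fin d)) ℝ,
      ∀ x : GL (Fin d) ℂ, MvPolynomial.eval (realCoord x.1) Q =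
        ∫ k : K, c k * MvPolynomial.eval (realCoord (x * k).1) P ∂μ := by
  have hint : ∀ f : K → ℝ, Continuous f → Integrable f μ := fun f hf =>
    hf.integrable_of_hasCompactSupport (HasCompactSupport.of_compactSpace f)
  have hcont : ∀ (x : GL (Fin d) ℂ) P, Continuous fun k : K =>
      MvPolynomial.eval (realCoord (x * k).1) P := fun x P =>
    (continuous_eval_realCoord P).comp (continuous_const.mul continuous_subtype_val)
  have hre : ∀ i j, Continuous fun k : K => (k.1.1 i j).re := fun i j =>
    (continuous_apply (Sum.inl (i, j))).comp (continuous_realCoord.comp continuous_subtype_val)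
  have him : ∀ i j, Continuous fun k : K => (k.1.1 i j).im := fun i j =>
    (continuous_apply (Sum.inr (i, j))).comp (continuous_realCoord.comp continuous_subtype_val)
  induction P using MvPolynomial.induction_on with
  | C a =>
    intro c _
    refine ⟨MvPolynomial.C (∫ k, c k * a ∂μ), fun x => ?_⟩
    simp
  | add P P' hP hP' =>
    intro c hc
    obtain ⟨Q, hQ⟩ := hP c hc
    obtain ⟨Q', hQ'⟩ := hP' c hc
    refine ⟨Q + Q', fun x => ?_⟩
    have h1 : Integrable (fun k : K => c k * MvPolynomial.eval (realCoord (x * k).1) P) μ :=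
      hint _ (hc.mul (hcont x P))
    have h2 : Integrable (fun k : K => c k * MvPolynomial.eval (realCoord (x * k).1) P') μ :=
      hint _ (hc.mul (hcont x P'))
    rw [map_add, hQ, hQ', ← integral_add h1 h2]
    simp only [map_add, mul_add]
  | mul_X P ij hP =>
    intro c hc
    choose Qr hQr using fun l j => hP (fun k => c k * (k.1.1 l j).re) (hc.mul (hre l j))
    choose Qi hQi using fun l j => hP (fun k => c k * (k.1.1 l j).im) (hc.mul (him l j))
    have h1 : ∀ (x : GL (Fin d) ℂ) l j, Integrable (fun k : K => c k * (k.1.1 l j).re *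
        MvPolynomial.eval (realCoord (x * k).1) P) μ := fun x l j =>
      hint _ ((hc.mul (hre l j)).mul (hcont x P))
    have h2 : ∀ (x : GL (Fin d) ℂ) l j, Integrable (fun k : K => c k * (k.1.1 l j).im *
        MvPolynomial.eval (realCoord (x * k).1) P) μ := fun x l j =>
      hint _ ((hc.mul (him l j)).mul (hcont x P))
    rcases ij with ⟨i, j⟩ | ⟨i, j⟩
    · refine ⟨∑ l, (MvPolynomial.X (Sum.inl (i, l)) * Qr l j -
        MvPolynomial.X (Sum.inr (i, l)) * Qi l j), fun x => ?_⟩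
      simp only [map_sum, map_sub, map_mul, MvPolynomial.eval_X, hQr, hQi]
      simp only [← integral_const_mul]
      simp_rw [← integral_sub ((h1 x _ j).const_mul _) ((h2 x _ j).const_mul _)]
      have h3 : ∀ l, Integrable (fun k : K => realCoord x.1 (Sum.inl (i, l)) *
          (c k * (k.1.1 l j).re * MvPolynomial.eval (realCoord (x * k).1) P) -
          realCoord x.1 (Sum.inr (i, l)) *
          (c k * (k.1.1 l j).im * MvPolynomial.eval (realCoord (x * k).1) P)) μ := fun l =>
        ((h1 x l j).const_mul _).sub ((h2 x l j).const_mul _)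
      rw [← integral_finsetSum _ fun l _ => h3 l]
      refine integral_congr_ae (ae_of_all _ fun k => ?_)
      simp only [realCoord, Sum.elim_inl, Sum.elim_inr, Units.val_mul, Matrix.mul_apply,
        Complex.re_sum, Complex.mul_re, Finset.mul_sum]
      refine Finset.sum_congr rfl fun l _ => ?_
      ring
    · refine ⟨∑ l, (MvPolynomial.X (Sum.inl (i, l)) * Qi l j +
        MvPolynomial.X (Sum.inr (i, l)) * Qr l j), fun x => ?_⟩
      simp only [map_sum, map_add, map_mul, MvPolynomial.eval_X, hQr, hQi]
      simp only [← integral_const_mul]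
      simp_rw [← integral_add ((h2 x _ j).const_mul _) ((h1 x _ j).const_mul _)]
      have h3 : ∀ l, Integrable (fun k : K => realCoord x.1 (Sum.inl (i, l)) *
          (c k * (k.1.1 l j).im * MvPolynomial.eval (realCoord (x * k).1) P) +
          realCoord x.1 (Sum.inr (i, l)) *
          (c k * (k.1.1 l j).re * MvPolynomial.eval (realCoord (x * k).1) P)) μ := fun l =>
        ((h2 x l j).const_mul _).add ((h1 x l j).const_mul _)
      rw [← integral_finsetSum _ fun l _ => h3 l]
      refine integral_congr_ae (ae_of_all _ fun k => ?_)
      simp only [realCoord, Sum.elim_inl, Sum.elim_inr, Units.val_mul, Matrix.mul_apply,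
        Complex.im_sum, Complex.mul_im, Finset.mul_sum]
      refine Finset.sum_congr rfl fun l _ => ?_
      ring

/-- Compact groups are real algebraic, so that a subgroup which is Zariski dense in a compact group
is dense for the usual topology. A polynomial which separates approximately the closure `K` of the
subgroup from a coset `g K` exists by the Stone-Weierstrass theorem, and its average over `K` is
constant on `K`, with another value at `g`. -/
theorem subset_closure_of_subset_zariskiClosure {N B : Subgroup (GL (Fin d) ℂ)}
    (hB : IsCompact (B : Set (GL (Fin d) ℂ))) (hNB : N ≤ B)
    (h : (B : Set (GL (Fin d) ℂ)) ⊆ zariskiClosure N) :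
    (B : Set (GL (Fin d) ℂ)) ⊆ closure N := by
  intro g hg
  by_contra hgN
  set K := N.topologicalClosure with hK
  have hKB : K ≤ B := N.topologicalClosure_minimal hNB hB.isClosed
  have hNK : N ≤ K := N.le_topologicalClosure
  have hKclosed : IsClosed (K : Set (GL (Fin d) ℂ)) := N.isClosed_topologicalClosure
  have hgK : g ∉ K := hgN
  have hKcompact : IsCompact (K : Set (GL (Fin d) ℂ)) := hB.of_isClosed_subset hKclosed hKB
  have : CompactSpace K := isCompact_iff_compactSpace.1 hKcompact
  have : CompactSpace B := isCompact_iff_compactSpace.1 hB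
  let : MeasurableSpace K := borel K
  have : BorelSpace K := ⟨rfl⟩
  let S : Set B := {x | x.1 ∈ K}
  let T : Set B := {x | g⁻¹ * x.1 ∈ K}
  have hS : IsClosed S := hKclosed.preimage continuous_subtype_val
  have hT : IsClosed T := hKclosed.preimage (continuous_const.mul continuous_subtype_val)
  have hST : Disjoint S T := by
    rw [Set.disjoint_left]
    intro x hx hx'
    refine hgK ?_
    have hx1 : x.1 ∈ K := hx
    have hx2 : g⁻¹ * x.1 ∈ K := hx'
    simpa using mul_mem hx1 (inv_mem hx2)
  obtain ⟨f, hf0, hf1, -⟩ := exists_continuous_zero_one_of_isClosed hS hT hST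
  let φ : MvPolynomial ((Fin d × Fin d) ⊕ (Fin d × Fin d)) ℝ →ₐ[ℝ] C(B, ℝ) :=
    MvPolynomial.aeval fun ij => ⟨fun x => realCoord x.1.1 ij,
      (continuous_apply ij).comp (continuous_realCoord.comp continuous_subtype_val)⟩
  have hφ : ∀ P (x : B), φ P x = MvPolynomial.eval (realCoord x.1.1) P := by
    intro P x
    have h2 : (ContinuousMap.evalAlgHom ℝ ℝ x).comp φ = MvPolynomial.aeval (realCoord x.1.1) :=
      MvPolynomial.algHom_ext fun ij => by
        rw [AlgHom.comp_apply, MvPolynomial.aeval_X, MvPolynomial.aeval_X]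
        rfl
    have h3 := DFunLike.congr_fun h2 P
    simpa [MvPolynomial.aeval_eq_eval] using h3
  have hsep : φ.range.SeparatesPoints := by
    intro x y hxy
    have h2 : realCoord x.1.1 ≠ realCoord y.1.1 := fun h =>
      hxy (Subtype.ext (realCoord_injective h))
    obtain ⟨ij, hij⟩ := Function.ne_iff.1 h2
    refine ⟨_, ⟨φ (MvPolynomial.X ij), ⟨_, rfl⟩, rfl⟩, ?_⟩
    simpa [hφ] using hij
  obtain ⟨⟨_, P, rfl⟩, hP⟩ :=
    ContinuousMap.exists_mem_subalgebra_near_continuousMap_of_separatesPoints φ.range hsep f (1 / 3)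
      (by norm_num)
  have hPf : ∀ x : B, |MvPolynomial.eval (realCoord x.1.1) P - f x| < 1 / 3 := by
    intro x
    rw [← hφ, ← Real.norm_eq_abs]
    exact (ContinuousMap.norm_coe_le_norm _ x).trans_lt hP
  let μ : Measure K := Measure.haarMeasure ⊤
  have : IsProbabilityMeasure μ := ⟨by
    have := Measure.haarMeasure_self (K₀ := (⊤ : TopologicalSpace.PositiveCompacts K))
    simpa using this⟩
  obtain ⟨Q, hQ⟩ := exists_eval_eq_integral μ P (fun _ => 1) continuous_const
  simp only [one_mul] at hQ
  have hcont : ∀ x : GL (Fin d) ℂ, Integrable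
      (fun k : K => MvPolynomial.eval (realCoord (x * k).1) P) μ := fun x =>
    Continuous.integrable_of_hasCompactSupport ((continuous_eval_realCoord P).comp
      (continuous_const.mul continuous_subtype_val)) (HasCompactSupport.of_compactSpace _)
  have hQK : ∀ x ∈ K, MvPolynomial.eval (realCoord x.1) Q =
      MvPolynomial.eval (realCoord (1 : GL (Fin d) ℂ).1) Q := by
    intro x hx
    rw [hQ, hQ]
    have := integral_mul_left_eq_self (μ := μ)
      (fun k : K => MvPolynomial.eval (realCoord k.1.1) P) ⟨x, hx⟩
    simpa using this
  have h1 : MvPolynomial.eval (realCoord (1 : GL (Fin d) ℂ).1) Q ≤ 1 / 3 := by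
    rw [hQ]
    have h2 := integral_mono (hcont 1) (integrable_const (1 / 3 : ℝ)) fun k => by
      have h3 := hPf ⟨k.1, hKB k.2⟩
      rw [hf0 (show (⟨k.1, hKB k.2⟩ : B) ∈ S from k.2)] at h3
      rw [one_mul]
      have h4 := (abs_lt.1 h3).2
      simp only [Pi.zero_apply, sub_zero] at h4
      exact h4.le
    simpa using h2
  have h2 : 2 / 3 ≤ MvPolynomial.eval (realCoord g.1) Q := by
    rw [hQ]
    have h2 := integral_mono (integrable_const (2 / 3 : ℝ)) (hcont g) fun k => by
      have h3 := hPf ⟨g * k.1, mul_mem hg (hKB k.2)⟩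
      rw [hf1 (show (⟨g * k.1, mul_mem hg (hKB k.2)⟩ : B) ∈ T by simp [T])] at h3
      have h4 := (abs_lt.1 h3).1
      simp only [Pi.one_apply] at h4
      show (2 / 3 : ℝ) ≤ MvPolynomial.eval (realCoord (g * k.1).1) P
      linarith
    simpa using h2
  have h3 := h hg (Q - MvPolynomial.C (MvPolynomial.eval (realCoord (1 : GL (Fin d) ℂ).1) Q))
    fun x hx => by
      rw [map_sub, MvPolynomial.eval_C, hQK x (hNK hx), sub_self]
  rw [map_sub, MvPolynomial.eval_C] at h3
  linarith

end Compact

/-! ### The definite case -/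

section Definite

variable {α : ℝ} {d : ℕ}

theorem continuous_form_self : Continuous fun x : Fin d → ℂ => form α x x := by
  unfold form
  fun_prop

theorem form_self_re_pos (h0 : 0 < α) (h1 : α < 1 / 2) (h : ((d : ℝ) + 1) * α < 1)
    {x : Fin d → ℂ} (hx : x ≠ 0) : 0 < (form α x x).re := by
  have hval : ∀ j : Fin d, 0 < eigVal α d j := fun j => by
    refine eigVal_pos h0 h1 ?_
    have hj : ((j : ℕ) : ℝ) + 1 ≤ d := by exact_mod_cast j.2
    linarith
  set c := (eigBasis α d).repr x with hc
  have hform : form α x x = ∑ j, c j * (starRingEnd ℂ) (c j) * ((d * eigVal α d j : ℝ) : ℂ) := by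
    have h2 : ∀ j, form α (eigBasis α d j) x =
        (starRingEnd ℂ) (c j) * ((d * eigVal α d j : ℝ) : ℂ) := by
      intro j
      rw [← conj_form, ← (eigBasis α d).sum_repr x, form_sum_left, Finset.sum_eq_single j]
      · rw [form_smul_left, eigBasis_apply, form_eigVec h0 h1, if_pos rfl, map_mul,
          Complex.conj_ofReal]
      · intro i _ hij
        rw [form_smul_left, eigBasis_apply, eigBasis_apply, form_eigVec h0 h1, if_neg hij, mul_zero]
      · exact fun hj => absurd (Finset.mem_univ j) hj
    calc form α x x = form α (∑ j, c j • eigBasis α d j) x := by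
          rw [(eigBasis α d).sum_repr x]
      _ = _ := by
          rw [form_sum_left]
          refine Finset.sum_congr rfl fun j _ => ?_
          rw [form_smul_left, h2, mul_assoc]
  have hre : (form α x x).re = ∑ j, Complex.normSq (c j) * (d * eigVal α d j) := by
    rw [hform, Complex.re_sum]
    refine Finset.sum_congr rfl fun j _ => ?_
    rw [Complex.mul_conj, ← Complex.ofReal_mul, Complex.ofReal_re]
  have hd : ∀ j : Fin d, (0 : ℝ) < d * eigVal α d j := fun j =>
    mul_pos (Nat.cast_pos.2 (Nat.zero_lt_of_lt j.2)) (hval j)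
  obtain ⟨j, hj⟩ : ∃ j, c j ≠ 0 := by
    by_contra! hc0
    refine hx ((eigBasis α d).repr.map_eq_zero_iff.1 (Finsupp.ext hc0))
  rw [hre]
  exact Finset.sum_pos' (fun i _ => mul_nonneg (Complex.normSq_nonneg _) (hd i).le)
    ⟨j, Finset.mem_univ j, mul_pos (Complex.normSq_pos.2 hj) (hd j)⟩

/-- A positive definite form is bounded below by a multiple of the square of the norm. -/
theorem exists_mul_norm_sq_le_form (h0 : 0 < α) (h1 : α < 1 / 2) (h : ((d : ℝ) + 1) * α < 1) :
    ∃ c : ℝ, 0 < c ∧ ∀ x : Fin d → ℂ, c * ‖x‖ ^ 2 ≤ (form α x x).re := by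
  obtain ⟨c, hc, hcs⟩ := (isCompact_sphere (0 : Fin d → ℂ) 1).exists_forall_le'
    (f := fun x => (form α x x).re) (Complex.continuous_re.comp continuous_form_self).continuousOn
    (a := 0) fun x hx => form_self_re_pos h0 h1 h (ne_zero_of_mem_unit_sphere ⟨x, hx⟩)
  refine ⟨c, hc, fun x => ?_⟩
  rcases eq_or_ne x 0 with rfl | hx
  · simp [form]
  have hx0 : ‖x‖ ≠ 0 := norm_ne_zero_iff.2 hx
  have h2 := hcs (((‖x‖⁻¹ : ℝ) : ℂ) • x) (by
    rw [mem_sphere_zero_iff_norm, norm_smul, Complex.norm_real, norm_inv, norm_norm,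
      inv_mul_cancel₀ hx0])
  rw [form_smul_left, form_smul_right, Complex.conj_ofReal, Complex.re_ofReal_mul,
    Complex.re_ofReal_mul] at h2
  have h3 : (form α x x).re = ‖x‖ ^ 2 * (‖x‖⁻¹ * (‖x‖⁻¹ * (form α x x).re)) := by
    field_simp
  rw [h3, mul_comm]
  gcongr

theorem isClosed_U : IsClosed (U α d : Set (GL (Fin d) ℂ)) := by
  have h : ∀ x y, IsClosed {g : GL (Fin d) ℂ | form α (g.1 *ᵥ x) (g.1 *ᵥ y) = form α x y} := by
    intro x y
    refine isClosed_eq ?_ continuous_const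
    have h2 : ∀ x i, Continuous fun g : GL (Fin d) ℂ => (g.1 *ᵥ x) i := fun x i =>
      (continuous_apply i).comp (Units.continuous_val.matrix_mulVec continuous_const)
    have h3 := h2 x
    have h4 := h2 y
    unfold form
    fun_prop
  have h2 : (U α d : Set (GL (Fin d) ℂ)) =
      ⋂ x, ⋂ y, {g : GL (Fin d) ℂ | form α (g.1 *ᵥ x) (g.1 *ᵥ y) = form α x y} := by
    ext g
    simp only [Set.mem_iInter]
    rfl
  rw [h2]
  exact isClosed_iInter fun x => isClosed_iInter fun y => h x y

/-- The unitary group of a definite form is compact: its elements and their inverses have bounded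
entries, since the columns are unit vectors. -/
theorem isCompact_U (h0 : 0 < α) (h1 : α < 1 / 2) (h : ((d : ℝ) + 1) * α < 1) :
    IsCompact (U α d : Set (GL (Fin d) ℂ)) := by
  obtain ⟨c, hc, hcf⟩ := exists_mul_norm_sq_le_form h0 h1 h
  let C : Set (Matrix (Fin d) (Fin d) ℂ) :=
    Set.univ.pi fun _ => Set.univ.pi fun _ => Metric.closedBall 0 (√(1 / c))
  have hC : IsCompact C :=
    isCompact_univ_pi fun _ => isCompact_univ_pi fun _ => isCompact_closedBall _ _
  have hUC : ∀ g ∈ U α d, g.1 ∈ C := by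
    intro g hg i _ j _
    rw [mem_closedBall_zero_iff]
    refine Real.le_sqrt_of_sq_le ?_
    rw [le_div_iff₀ hc]
    have h2 := hcf (g.1 *ᵥ e j)
    rw [hg, form_e_e, gram, if_pos rfl, Complex.one_re] at h2
    have h3 : ‖g.1 i j‖ ≤ ‖g.1 *ᵥ e j‖ := by
      have := norm_le_pi_norm (g.1 *ᵥ e j) i
      simpa [e] using this
    calc ‖g.1 i j‖ ^ 2 * c ≤ ‖g.1 *ᵥ e j‖ ^ 2 * c := by gcongr
      _ = c * ‖g.1 *ᵥ e j‖ ^ 2 := mul_comm _ _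
      _ ≤ 1 := h2
  have hK : IsCompact (C ×ˢ (MulOpposite.unop ⁻¹' C)) :=
    hC.prod ((MulOpposite.opHomeomorph.symm.isClosedEmbedding).isCompact_preimage hC)
  refine (Units.isClosedEmbedding_embedProduct.isCompact_preimage hK).of_isClosed_subset
    isClosed_U fun g hg => ⟨hUC g hg, hUC g⁻¹ (inv_mem hg)⟩

theorem isCompact_SU (h0 : 0 < α) (h1 : α < 1 / 2) (h : ((d : ℝ) + 1) * α < 1) :
    IsCompact (SU α d : Set (GL (Fin d) ℂ)) := by
  refine (isCompact_U h0 h1 h).of_isClosed_subset ?_ fun g hg => hg.1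
  have h2 : (SU α d : Set (GL (Fin d) ℂ)) =
      (U α d : Set (GL (Fin d) ℂ)) ∩ {g | g.1.det = 1} := by
    ext g
    rw [Set.mem_inter_iff, SetLike.mem_coe, SU, Subgroup.mem_inf, mem_SL_iff]
    rfl
  rw [h2]
  exact isClosed_U.inter
    (isClosed_eq (Continuous.matrix_det Units.continuous_val) continuous_const)

theorem denseIn_SU (h0 : 0 < α) (h1 : α < 1 / 2) (h : ((d : ℝ) + 1) * α < 1)
    {N : Subgroup (GL (Fin d) ℂ)} (hN : ZariskiDenseIn N (SU α d)) : DenseIn N (SU α d) :=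
  ⟨hN.1, subset_closure_of_subset_zariskiClosure (isCompact_SU h0 h1 h) hN.1 hN.2⟩

end Definite

end RauzyVeech

/-! ### Conclusion -/

theorem mainTheorem3 :
    -- The step from the degenerate to the non-degenerate case.
    (∀ (d : ℕ) (α : ℝ), 5 ≤ d → 0 < α → α < 1 / 2 → (∃ m : ℤ, (d : ℝ) * α = m) →
      RauzyVeech.kernel α d = {0} ∧
      (∀ p : Fin d, ∃ w : Fin d → ℂ, w ≠ 0 ∧ w p = 0 ∧
        ∀ y : Fin d → ℂ, y p = 0 → RauzyVeech.form α w y = 0) ∧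
      (RauzyVeech.DenseIn (RauzyVeech.opGroup α (d - 1) ⊓ RauzyVeech.SL (d - 1))
            (RauzyVeech.SUstar α (d - 1)) ∨
          RauzyVeech.ZariskiDenseIn (RauzyVeech.opGroup α (d - 1) ⊓ RauzyVeech.SL (d - 1))
            (RauzyVeech.SUstar α (d - 1)) →
        RauzyVeech.ZariskiDenseIn (RauzyVeech.opGroup α d ⊓ RauzyVeech.SU α d)
          (RauzyVeech.SU α d))) ∧
    -- The outcome of the induction.
    (∀ (d : ℕ) (α : ℝ), 2 ≤ d → 0 < α → α < 1 / 2 →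
      RauzyVeech.opGroup α d ≤ RauzyVeech.U α d ∧
      RauzyVeech.HasSignature α d ⌈((d : ℝ) + 1) * (1 - α) - 1⌉ ⌈((d : ℝ) + 1) * α - 1⌉ ∧
      (α ≠ 1 / 6 → α ≠ 1 / 4 → ¬ (d = 2 ∧ (α = 1 / 10 ∨ α = 3 / 10)) →
        (((d : ℝ) + 1) * α < 1 →
          RauzyVeech.DenseIn (RauzyVeech.opGroup α d ⊓ RauzyVeech.SU α d)
            (RauzyVeech.SU α d)) ∧
        ((¬ ∃ m : ℤ, ((d : ℝ) + 1) * α = m) →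
          RauzyVeech.ZariskiDenseIn (RauzyVeech.opGroup α d ⊓ RauzyVeech.SU α d)
            (RauzyVeech.SU α d)))) := by
  constructor
  · intro d α hd h0 h1 hm
    obtain ⟨m, hm⟩ := hm
    have hint : ¬ ∃ n : ℤ, ((d : ℝ) + 1) * α = n := by
      rintro ⟨n, hn⟩
      have h2 : α = ((n - m : ℤ) : ℝ) := by push_cast; linarith
      have h3 : (0 : ℝ) < ((n - m : ℤ) : ℝ) := h2 ▸ h0
      have h4 : ((n - m : ℤ) : ℝ) < 1 := by linarith
      have h5 : 0 < n - m := by exact_mod_cast h3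
      have h6 : n - m < 1 := by exact_mod_cast h4
      omega
    have hk := RauzyVeech.kernel_eq_of_not_int h0 h1 hint
    refine ⟨hk, fun p => ?_, fun _ => ?_⟩
    · obtain ⟨d, rfl⟩ : ∃ n, d = n + 1 := ⟨d - 1, by omega⟩
      obtain ⟨x, hx, hxf⟩ := RauzyVeech.exists_ne_zero_forall_form_eq_zero h0 h1
        (show 1 ≤ d by omega) (m := m) (by rw [← hm]; push_cast; ring)
      refine ⟨p.insertNth (α := fun _ => ℂ) 0 x, fun h => hx ?_, by simp, fun y hy => ?_⟩
      · funext i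
        have := congrFun h (p.succAbove i)
        simpa using this
      · rw [RauzyVeech.form_insertNth p x hy, hxf]
    · refine RauzyVeech.zariskiDenseIn_SU h0 h1 (by omega) hk (fun h => ?_) (fun h => ?_)
        (fun _ => by omega)
      · have h2 : (d : ℝ) = ((6 * m : ℤ) : ℝ) := by rw [h] at hm; push_cast; linarith
        have h3 : (d : ℤ) = 6 * m := by exact_mod_cast h2
        omega
      · omega
  · intro d α hd h0 h1
    refine ⟨RauzyVeech.opGroup_le_U h0 h1 d, RauzyVeech.hasSignature h0 h1 hd,
      fun h6 h4 h10 => ?_⟩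
    have key : (¬ ∃ m : ℤ, ((d : ℝ) + 1) * α = m) →
        RauzyVeech.ZariskiDenseIn (RauzyVeech.opGroup α d ⊓ RauzyVeech.SU α d)
          (RauzyVeech.SU α d) := by
      intro hint
      refine RauzyVeech.zariskiDenseIn_SU h0 h1 hd (RauzyVeech.kernel_eq_of_not_int h0 h1 hint)
        (fun h => absurd h h6) (fun h => absurd h h4) (fun h => ?_)
      by_contra hd3
      obtain rfl : d = 2 := by omega
      rcases h with h | h | h
      · exact h10 ⟨rfl, Or.inl h⟩
      · exact h10 ⟨rfl, Or.inr h⟩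
      · exact hint ⟨1, by rw [h]; norm_num⟩
    refine ⟨fun h => RauzyVeech.denseIn_SU h0 h1 h (key ?_), key⟩
    rintro ⟨m, hm⟩
    have h2 : (0 : ℝ) < (m : ℝ) := hm ▸ mul_pos (by positivity) h0
    have h3 : (m : ℝ) < 1 := hm ▸ h
    have h4 : 0 < m := by exact_mod_cast h2
    have h5 : m < 1 := by exact_mod_cast h3
    omega
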